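/- Let $k$ be a field of characteristic $p>0$, let $V$ be a finite dimensional vector space over $k$, and let $G\le \mathrm{GL}(V)$ be a finite abelian $p$-group. Let $k[V]=\mathrm{Sym}(V^*)$ be the coordinate ring, on which $G$ acts by graded $k$-algebra automorphisms, and let $k[V]^G$ be the ring of invariants. The transfer is the $k[V]^G$-linear map $$\mathrm{Tr}^G: k[V]\to k[V]^G,\qquad \mathrm{Tr}^G(f)=\sum_{\sigma\in G}\sigma(f).$$ The action is called coregular if $k[V]^G$ is generated as a $k$-algebra by $n=\dim V$ algebraically independent homogeneous invariants. Then the image of $\mathrm{Tr}^G$ is a principal ideal of $k[V]^G$ if and only if the action is coregular. -/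

import Mathlib

noncomputable section

namespace InvariantTheory

variable (k V : Type*) [Field k] [AddCommGroup V] [Module k V]

/-- The coordinate ring `k[V]`: the symmetric algebra on the dual space of `V`. -/
abbrev CoordinateRing : Type _ := SymmetricAlgebra k (Module.Dual k V)

/-- The homogeneous component `k[V]_d`: the span of the `d`-fold products of linear forms. -/
def homogeneousPart (d : ℕ) : Submodule k (CoordinateRing k V) :=
  LinearMap.range (SymmetricAlgebra.ι k (Module.Dual k V)) ^ d

variable {k V}

/-- The tautological representation of `GL(V)` on `V`. -/
def tautologicalRep : Representation k (LinearMap.GeneralLinearGroup k V) V :=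
  Units.coeHom (Module.End k V)

/-- The action of `GL(V)` on `k[V]` by algebra endomorphisms that extends the contragredient
action `(σ • x)(v) = x (σ⁻¹ v)` on linear forms `x`. -/
def coordAction :
    LinearMap.GeneralLinearGroup k V →* (CoordinateRing k V →ₐ[k] CoordinateRing k V) where
  toFun σ := SymmetricAlgebra.lift
    (SymmetricAlgebra.ι k (Module.Dual k V) ∘ₗ (tautologicalRep (k := k) (V := V)).dual σ)
  map_one' := by
    apply SymmetricAlgebra.algHom_ext
    ext x
    simp
    rfl
  map_mul' σ τ := by
    apply SymmetricAlgebra.algHom_ext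
    ext x
    simp
    rfl

/-- The ring of invariants `k[V]^G`. -/
def invariantRing (G : Subgroup (LinearMap.GeneralLinearGroup k V)) :
    Subalgebra k (CoordinateRing k V) where
  carrier := {f | ∀ σ ∈ G, coordAction σ f = f}
  mul_mem' hf hg σ hσ := by rw [map_mul, hf σ hσ, hg σ hσ]
  add_mem' hf hg σ hσ := by rw [map_add, hf σ hσ, hg σ hσ]
  algebraMap_mem' c σ _ := (coordAction σ).commutes c

/-- The transfer `Tr^G(f) = ∑_{σ ∈ G} σ(f)`, as a `k[V]^G`-linear map `k[V] → k[V]^G`. -/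
def transfer (G : Subgroup (LinearMap.GeneralLinearGroup k V)) [Fintype G] :
    CoordinateRing k V →ₗ[invariantRing G] invariantRing G where
  toFun f := ⟨∑ σ : G, coordAction (σ : LinearMap.GeneralLinearGroup k V) f, by
    intro τ hτ
    rw [map_sum]
    refine Fintype.sum_equiv (Equiv.mulLeft (⟨τ, hτ⟩ : G)) _ _ fun σ => ?_
    simp [map_mul]⟩
  map_add' f g := by
    apply Subtype.ext
    simp [Finset.sum_add_distrib]
  map_smul' c f := by
    apply Subtype.ext
    have hc : ∀ σ : G, coordAction (σ : LinearMap.GeneralLinearGroup k V)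
        (c : CoordinateRing k V) = c := fun σ => c.2 σ σ.2
    simp [Subalgebra.smul_def, Finset.mul_sum, hc]

/-- The action of `G` on `V` is coregular: with `n = dim V`, the algebra `k[V]^G` is generated by
`n` algebraically independent homogeneous invariants. -/
def IsCoregular (G : Subgroup (LinearMap.GeneralLinearGroup k V)) : Prop :=
  ∃ f : Fin (Module.finrank k V) → CoordinateRing k V,
    (∀ i, ∃ d : ℕ, f i ∈ homogeneousPart k V d) ∧
    AlgebraicIndependent k f ∧
    Algebra.adjoin k (Set.range f) = invariantRing G

end InvariantTheory

end

/-! In a basis of linear forms everything becomes a statement about a finite group Γ acting linearly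
on S = k[X], with invariant ring B.

Principal implies coregular. A generator d of the transfer ideal divides every transfer in S. Let H
be the subgroup generated by the reflections. If g lies outside H, no prime q of S can divide gc - c
for all H-invariants c: otherwise g agrees modulo q on the variables with some h in H, and h⁻¹g is a
reflection (`exists_not_dvd_sub_of_notMem`). Since Γ is abelian, this lets d divide all H-transfers
(`dvd_sum_subgroup_of_dvd_sum`). Writing d itself as a transfer, first over H and then over Γ/H, and
cancelling d, one gets 1 = [Γ:H]·c at constant terms, so H = Γ. Commuting unipotent reflections act
trivially on each other's images, so V* has a basis x, y with x fixed and y moved by linear forms in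
x. The map a ↦ Tr(a₀a)/d, where Tr(a₀) = d, is a B-linear retraction of S onto B. Setting x = 0
sends B to a graded direct summand of k[y] which is stable under translations and contains p-power
powers of the y's. Such a subalgebra in r variables has r homogeneous generators
(`isGeneratedByHomogeneous_of_isTranslationStable`): either it contains a linear form, which can be
divided out, or all derivatives vanish on it and it lies in k[y^p], where the p can be removed.
Lifting generators back along the retraction gives n = dim V homogeneous generators of B, and
transcendence degree makes them independent.

Coregular implies principal. Let B = k[f], with f_j of degree d_j, and lift a monomial basis of
S/(f) to e_1, ..., e_μ. Then S is free over B on the e_i: modulo (f^q), q a power of p, the products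
X^α e_i^q are independent and the products f^β e_i span, and the two families have the same size, so
both are bases. Comparing their degrees also gives 2 Σ deg e_i = μ Σ (d_j - 1). The Bezoutian D(x,
y) of f vanishes at (gx, x) for g ≠ 1 and restricts to the Jacobian J on the diagonal. Write D = Σ
c_ij e_i(x) e_j(y) on these graphs with c_ij in B. Summing g(e_i) D(gx, x) over g gives T M = J·1
for T = (Tr(e_i e_j)) and M = (c_ij). By the degree formula det M has degree 0; it is nonzero, so M
is invertible over B and T = J M⁻¹. Hence the transfer ideal is J·B
(`exists_generator_of_algebraicIndependent`). -/

noncomputable section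

namespace InvariantTheory

/-! ### Inertia modulo a prime element, and transfers for a subgroup -/

section Congruence

variable {k A Γ : Type*} [Field k] [CommRing A] [Algebra k A] [Group Γ]

open Polynomial in
/-- If `g` acts trivially on the `H`-invariants modulo a prime element `q`, then on any finite
family it agrees modulo `q` with some element of `H`. -/
theorem exists_mem_dvd_sub_of_dvd_sub_invariant [IsDomain A] (φ : Γ →* (A →ₐ[k] A))
    (H : Subgroup Γ) [Finite H] {q : A} (hq : Prime q) (g : Γ)
    (hg : ∀ c : A, (∀ h ∈ H, φ h c = c) → q ∣ φ g c - c) {n : ℕ} (x : Fin n → A) :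
    ∃ h ∈ H, ∀ i, q ∣ φ g (x i) - φ h (x i) := by
  classical
  have := Fintype.ofFinite H
  let Φ : Γ → (A[X] →+* A[X]) := fun σ => mapRingHom (φ σ : A →+* A)
  have hΦmul : ∀ σ τ y, Φ (σ * τ) y = Φ σ (Φ τ y) := by
    intro σ τ y
    ext i
    simp [Φ]
  have hΦone : ∀ y, Φ 1 y = y := by
    intro y
    ext i
    simp [Φ]
  -- The whole family is packed into one element `a`, so that a single h works for all i. `F` has
  -- the H-conjugates of `a` as roots; its coefficients are H-invariant, so applying g does not
  -- change it modulo q, and q divides F(ga) = ∏ (ga - ha).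
  let a : A[X] := ∑ i : Fin n, C (x i) * X ^ (i : ℕ)
  let F : A[X][X] := ∏ h : H, (X - C (Φ h a))
  have hFix : ∀ τ : H, F.map (Φ τ) = F := by
    intro τ
    simp only [F, Polynomial.map_prod, Polynomial.map_sub, map_X, map_C]
    refine Fintype.prod_equiv (Equiv.mulLeft τ) _ _ fun h => ?_
    simp [hΦmul]
  have hdvd : C (C q) ∣ F.map (Φ g) - F := by
    rw [C_dvd_iff_dvd_coeff]
    intro m
    rw [C_dvd_iff_dvd_coeff]
    intro i
    have : (φ g) ((F.coeff m).coeff i) - (F.coeff m).coeff i =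
        ((F.map (Φ g) - F).coeff m).coeff i := by
      simp [Φ]
    rw [← this]
    refine hg _ fun h hh => ?_
    have h1 := congrArg (fun P : A[X][X] => (P.coeff m).coeff i) (hFix ⟨h, hh⟩)
    simpa [Φ] using h1
  have hev : C q ∣ eval (Φ g a) (F.map (Φ g) - F) := by
    have := map_dvd (evalRingHom (Φ g a)) hdvd
    simpa using this
  have h0 : eval (Φ g a) (F.map (Φ g)) = 0 := by
    rw [eval_map_apply]
    have : eval a F = 0 := by
      rw [eval_prod]
      refine Finset.prod_eq_zero (Finset.mem_univ (1 : H)) ?_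
      simp [hΦone]
    rw [this, map_zero]
  rw [eval_sub, h0, zero_sub, dvd_neg, eval_prod] at hev
  obtain ⟨h, -, hh⟩ := (Prime.dvd_finsetProd_iff (prime_C_iff.2 hq) _).1 hev
  refine ⟨h, h.2, fun i => ?_⟩
  rw [eval_sub, eval_X, eval_C, C_dvd_iff_dvd_coeff] at hh
  have := hh i
  have hc : ∀ σ, (Φ σ a).coeff (i : ℕ) = φ σ (x i) := by
    intro σ
    simp only [Φ, coe_mapRingHom, coeff_map, a, finsetSum_coeff, coeff_C_mul, coeff_X_pow]
    simp [Fin.ext_iff.symm.eq]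
  rwa [coeff_sub, hc, hc] at this

/-- If `d` divides every `Γ`-transfer, it divides every transfer twisted by a product of
differences. -/
theorem dvd_sum_mul_prod_sub [Fintype Γ] (φ : Γ →* (A →ₐ[k] A)) {d : A}
    (hd : ∀ a, d ∣ ∑ g, φ g a) {β : Type*} (S : Finset β) (c c' : β → A) (a : A) :
    d ∣ ∑ g, φ g a * ∏ s ∈ S, (c s - φ g (c' s)) := by
  classical
  induction S using Finset.induction_on generalizing a with
  | empty => simpa using hd a
  | insert s S hs ih =>
    have : ∑ g, φ g a * ∏ t ∈ insert s S, (c t - φ g (c' t)) =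
        c s * (∑ g, φ g a * ∏ t ∈ S, (c t - φ g (c' t))) -
          ∑ g, φ g (a * c' s) * ∏ t ∈ S, (c t - φ g (c' t)) := by
      rw [Finset.mul_sum, ← Finset.sum_sub_distrib]
      refine Finset.sum_congr rfl fun g _ => ?_
      rw [Finset.prod_insert hs, map_mul]
      ring
    rw [this]
    exact dvd_sub (Dvd.dvd.mul_left (ih a) _) (ih _)

/-- Cancel the common factors of d and b: a prime q left over in d would have to divide the
multiplier u chosen for that very q. -/
theorem dvd_of_forall_prime_exists_dvd_mul [IsDomain A] [UniqueFactorizationMonoid A] {d b : A}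
    (hd : d ≠ 0) (h : ∀ q, Prime q → ∃ u, ¬ q ∣ u ∧ d ∣ u * b) : d ∣ b := by
  obtain ⟨d', b', c, hrel, rfl, rfl⟩ := UniqueFactorizationMonoid.exists_reduced_factors d hd b
  have hc : c ≠ 0 := left_ne_zero_of_mul hd
  have hd' : d' ≠ 0 := right_ne_zero_of_mul hd
  by_cases hu : IsUnit d'
  · exact mul_dvd_mul_left _ hu.dvd
  obtain ⟨q, hq, hqd⟩ := WfDvdMonoid.exists_irreducible_factor hu hd'
  obtain ⟨u, hqu, hdu⟩ := h q hq.prime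
  rw [mul_left_comm, mul_dvd_mul_iff_left hc] at hdu
  exact absurd (hqd.trans (hrel.dvd_of_dvd_mul_right hdu)) hqu

/-- A divisor of all `Γ`-transfers divides all transfers for a subgroup `H` without inertia
outside `H`. -/
theorem dvd_sum_subgroup_of_dvd_sum [IsDomain A] [UniqueFactorizationMonoid A] [Fintype Γ]
    (hcomm : ∀ g h : Γ, g * h = h * g)
    (φ : Γ →* (A →ₐ[k] A)) (H : Subgroup Γ) [Fintype H] {d : A} (hd0 : d ≠ 0)
    (hd : ∀ a, d ∣ ∑ g, φ g a)
    (hin : ∀ q, Prime q → ∀ g, g ∉ H → ∃ c, (∀ h ∈ H, φ h c = c) ∧ ¬ q ∣ φ g c - c) (a : A) :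
    d ∣ ∑ h : H, φ h a := by
  classical
  refine dvd_of_forall_prime_exists_dvd_mul hd0 fun q hq => ?_
  have hin' : ∀ g, ∃ c, (∀ h ∈ H, φ h c = c) ∧ (g ∉ H → ¬ q ∣ c - φ g⁻¹ c) := by
    intro g
    by_cases hg : g ∈ H
    · exact ⟨1, by simp, fun h => absurd hg h⟩
    · obtain ⟨c, hc, hc'⟩ := hin q hq g⁻¹ (by simpa using hg)
      exact ⟨c, hc, fun _ h => hc' (by rw [← neg_sub]; exact (dvd_neg).2 h)⟩
  choose c hcH hcq using hin'
  let S : Finset Γ := Finset.univ.filter (· ∉ H)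
  refine ⟨∏ g ∈ S, (c g - φ g⁻¹ (c g)), ?_, ?_⟩
  · intro h
    obtain ⟨g, hg, hg'⟩ := (Prime.dvd_finsetProd_iff hq _).1 h
    exact hcq g (by simpa [S] using hg) hg'
  · have := dvd_sum_mul_prod_sub φ hd S c (fun g => φ g⁻¹ (c g)) a
    convert this using 1
    rw [Finset.mul_sum]
    -- The twisted product is a filter for H: for g outside H the factor s = g vanishes, and for g
    -- in H commutativity and the H-invariance of `c s` make the product independent of g. What
    -- remains is the multiplier times the H-transfer of a.
    have h1 : ∀ g : Γ, φ g a * ∏ s ∈ S, (c s - φ g (φ s⁻¹ (c s))) =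
        if g ∈ H then φ g a * ∏ s ∈ S, (c s - φ s⁻¹ (c s)) else 0 := by
      intro g
      split_ifs with hg
      · congr 1
        refine Finset.prod_congr rfl fun s _ => ?_
        have : φ g (φ s⁻¹ (c s)) = φ s⁻¹ (φ g (c s)) := by
          rw [← AlgHom.mul_apply, ← map_mul, hcomm, map_mul, AlgHom.mul_apply]
        rw [this, hcH s g hg]
      · rw [Finset.prod_eq_zero (i := g) (by simpa [S] using hg), mul_zero]
        rw [← AlgHom.mul_apply, ← map_mul]
        simp
    rw [Finset.sum_congr rfl fun g _ => h1 g, ← Finset.sum_filter]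
    rw [Finset.sum_subtype (p := (· ∈ H)) (Finset.univ.filter (· ∈ H)) (by simp)]
    exact Finset.sum_congr rfl fun h _ => mul_comm _ _

/-- If a nonzero invariant `d` is a transfer and divides all transfers of `H`-orbits, then `H` has
index prime to the characteristic; for `p`-groups, `H` is everything. -/
theorem eq_top_of_dvd_sum_subgroup [IsDomain A] [Fintype Γ] (p : ℕ) [Fact p.Prime] [CharP k p]
    (hp : IsPGroup p Γ) (φ : Γ →* (A →ₐ[k] A)) (ε : A →ₐ[k] k) (hε : ∀ g a, ε (φ g a) = ε a)
    (H : Subgroup Γ) [Fintype H] {d : A} (hd0 : d ≠ 0) (hdinv : ∀ g, φ g d = d)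
    (hdim : ∃ a, ∑ g, φ g a = d) (hd : ∀ a, d ∣ ∑ h : H, φ h a) : H = ⊤ := by
  classical
  obtain ⟨a, ha⟩ := hdim
  obtain ⟨c, hc⟩ := hd a
  have := Fintype.ofFinite (Γ ⧸ H)
  have h1 : ∑ g, φ g a = ∑ x : Γ ⧸ H, φ x.out (∑ h : H, φ h a) := by
    have hbij : Function.Bijective (fun y : (Γ ⧸ H) × H => y.1.out * (y.2 : Γ)) := by
      constructor
      · rintro ⟨x, h⟩ ⟨x', h'⟩ hxy
        have hxy' : x.out * (h : Γ) = x'.out * (h' : Γ) := hxy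
        have hx : x = x' := by
          have := congrArg (QuotientGroup.mk : Γ → Γ ⧸ H) hxy'
          simpa using this
        subst hx
        simpa using hxy'
      · intro g
        have hm : ((g : Γ ⧸ H).out)⁻¹ * g ∈ H := by
          rw [← QuotientGroup.eq]
          simp
        exact ⟨⟨g, ⟨_, hm⟩⟩, by simp⟩
    rw [← Fintype.sum_bijective _ hbij (fun y => φ y.1.out (φ y.2 a)) (fun g => φ g a),
      Fintype.sum_prod_type]
    · simp [map_sum]
    · rintro ⟨x, h⟩
      simp
  rw [ha, hc] at h1
  simp only [map_mul, hdinv, ← Finset.mul_sum] at h1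
  have h2 : (1 : A) = ∑ x : Γ ⧸ H, φ x.out c := mul_left_cancel₀ hd0 (by rw [← h1, mul_one])
  -- Under ε all conjugates of c have the same value, so the right side becomes the index of H times
  -- ε(c). A positive power of p would make it 0.
  have h3 := congrArg ε h2
  simp only [map_one, map_sum, hε, Finset.sum_const, Finset.card_univ, nsmul_eq_mul] at h3
  obtain ⟨j, hj⟩ := (hp.index H)
  rw [Subgroup.index_eq_card, Nat.card_eq_fintype_card] at hj
  rcases Nat.eq_zero_or_pos j with rfl | hj0
  · rw [← Subgroup.index_eq_one, Subgroup.index_eq_card, Nat.card_eq_fintype_card, hj, pow_zero]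
  · rw [hj] at h3
    simp [hj0.ne'] at h3

/-- Dedekind's independence of characters: distinct multiplicative maps into a domain satisfy no
linear relation, in particular not the one with all coefficients 1. -/
theorem exists_sum_ne_zero [IsDomain A] [Fintype Γ] (φ : Γ →* (A →ₐ[k] A))
    (hφ : Function.Injective φ) : ∃ a, ∑ g, φ g a ≠ 0 := by
  classical
  by_contra! h
  have hli := linearIndependent_monoidHom A A
  have hinj : Function.Injective (fun g : Γ => ((φ g : A →* A))) := by
    intro g h hgh
    refine hφ (AlgHom.ext fun a => ?_)
    exact DFunLike.congr_fun hgh a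
  have := hli.comp _ hinj
  rw [Fintype.linearIndependent_iff] at this
  have h1 := this (fun _ => 1) (by
    ext a
    simpa using h a) 1
  exact one_ne_zero h1

end Congruence

end InvariantTheory

end


noncomputable section

namespace InvariantTheory

/-! ### Linear actions on polynomial rings and generation by reflections -/

section LinearAction

open MvPolynomial

variable {k ι Γ : Type*} [Field k] [Group Γ]

/-- A prime is nonconstant, so its cofactor in a nonzero linear form has degree 0; both forms are
therefore multiples of q by scalars. -/
theorem exists_eq_smul_of_prime_dvd {q l₁ l₂ : MvPolynomial ι k} (hq : Prime q)
    (h₁ : l₁.IsHomogeneous 1) (h₂ : l₂.IsHomogeneous 1) (hl₁ : l₁ ≠ 0) (hd₁ : q ∣ l₁)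
    (hd₂ : q ∣ l₂) : ∃ c : k, l₂ = c • l₁ := by
  have key : ∀ l : MvPolynomial ι k, l.IsHomogeneous 1 → l ≠ 0 → q ∣ l →
      ∃ c : k, l = c • q := by
    rintro l hl hl0 ⟨u, rfl⟩
    have hu0 : u ≠ 0 := right_ne_zero_of_mul hl0
    have hdeg := hl.totalDegree hl0
    rw [totalDegree_mul_of_isDomain hq.ne_zero hu0] at hdeg
    have hq1 : q.totalDegree ≠ 0 := by
      intro h0
      obtain h := totalDegree_eq_zero_iff_eq_C.1 h0
      refine hq.not_isUnit ?_
      rw [h]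
      refine (IsUnit.mk0 _ ?_).map C
      intro h1
      rw [h1, C_0] at h
      exact hq.ne_zero h
    have hu := totalDegree_eq_zero_iff_eq_C.1 (show u.totalDegree = 0 by omega)
    refine ⟨coeff 0 u, ?_⟩
    rw [smul_eq_C_mul, mul_comm]
    congr 1
  obtain ⟨c₁, hc₁⟩ := key l₁ h₁ hl₁ hd₁
  by_cases hl₂ : l₂ = 0
  · exact ⟨0, by simp [hl₂]⟩
  obtain ⟨c₂, hc₂⟩ := key l₂ h₂ hl₂ hd₂
  have : c₁ ≠ 0 := by
    rintro rfl
    simp at hc₁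
    exact hl₁ hc₁
  refine ⟨c₂ * c₁⁻¹, ?_⟩
  rw [hc₂, hc₁, smul_smul]
  congr 1
  field_simp

/-- The action of `Γ` on a polynomial ring is linear if it preserves linear forms. -/
def IsLinearAction (φ : Γ →* (MvPolynomial ι k →ₐ[k] MvPolynomial ι k)) : Prop :=
  ∀ g i, (φ g (X i)).IsHomogeneous 1

theorem isHomogeneous_algHom_apply {κ : Type*} {ψ : MvPolynomial ι k →ₐ[k] MvPolynomial κ k}
    (hψ : ∀ i, (ψ (X i)).IsHomogeneous 1) {f : MvPolynomial ι k} {d : ℕ}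
    (hf : f.IsHomogeneous d) : (ψ f).IsHomogeneous d := by
  have : ψ f = aeval (fun i => ψ (X i)) f :=
    DFunLike.congr_fun (MvPolynomial.aeval_unique ψ) f
  rw [this]
  have := hf.aeval (fun i => ψ (X i)) hψ
  rwa [one_mul] at this

theorem homogeneousComponent_algHom_apply {κ : Type*}
    {ψ : MvPolynomial ι k →ₐ[k] MvPolynomial κ k}
    (hψ : ∀ i, (ψ (X i)).IsHomogeneous 1) (f : MvPolynomial ι k) (d : ℕ) :
    homogeneousComponent d (ψ f) = ψ (homogeneousComponent d f) := by
  conv_lhs => rw [← sum_homogeneousComponent f]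
  rw [map_sum, map_sum]
  have : ∀ i, homogeneousComponent d (ψ (homogeneousComponent i f)) =
      if i = d then ψ (homogeneousComponent d f) else 0 := by
    intro i
    rw [homogeneousComponent_of_mem
      (isHomogeneous_algHom_apply hψ (homogeneousComponent_isHomogeneous i f))]
    split_ifs with h1 h2 h2
    · rw [h1]
    · exact absurd h1.symm h2
    · exact absurd h2.symm h1
    · rfl
  simp only [this, Finset.sum_ite_eq', Finset.mem_range]
  split_ifs with h
  · rfl
  · rw [homogeneousComponent_eq_zero _ _ (by omega), map_zero]

theorem IsLinearAction.coeff_zero {φ : Γ →* (MvPolynomial ι k →ₐ[k] MvPolynomial ι k)}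
    (hφ : IsLinearAction φ) (g : Γ) (f : MvPolynomial ι k) :
    coeff 0 (φ g f) = coeff 0 f := by
  have := congrArg (coeff 0) (homogeneousComponent_algHom_apply (hφ g) f 0)
  rw [homogeneousComponent_zero, homogeneousComponent_zero, algHom_C] at this
  simpa using this

/-- `σ` acts on linear forms as a reflection (or trivially): the image of `σ - 1` is at most
one-dimensional. -/
def IsReflection (φ : Γ →* (MvPolynomial ι k →ₐ[k] MvPolynomial ι k)) (σ : Γ) : Prop :=
  ∃ i₀, ∀ i, ∃ c : k, φ σ (X i) - X i = c • (φ σ (X i₀) - X i₀)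

/-- A subgroup containing all reflections has no inertia outside. -/
theorem exists_not_dvd_sub_of_notMem [Fintype ι] [Finite Γ]
    {φ : Γ →* (MvPolynomial ι k →ₐ[k] MvPolynomial ι k)} (hφ : IsLinearAction φ)
    (hinj : Function.Injective φ) (H : Subgroup Γ) (hH : ∀ σ, IsReflection φ σ → σ ∈ H)
    {q : MvPolynomial ι k} (hq : Prime q) {g : Γ} (hg : g ∉ H) :
    ∃ c, (∀ h ∈ H, φ h c = c) ∧ ¬ q ∣ φ g c - c := by
  by_contra! hcon
  let e := Fintype.equivFin ι
  obtain ⟨h, hh, hdvd⟩ := exists_mem_dvd_sub_of_dvd_sub_invariant φ H hq g hcon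
    (fun i => X (e.symm i))
  refine hg ?_
  have hcomp : ∀ (a b : Γ) f, φ a (φ b f) = φ (a * b) f := fun a b f => by
    rw [map_mul, AlgHom.mul_apply]
  -- Moving h to the other side, `h⁻¹ * g` shifts every variable by a linear form divisible by one
  -- fixed prime. These forms are proportional, so it is a reflection or trivial.
  have hdvd' : ∀ i, φ h⁻¹ q ∣ φ (h⁻¹ * g) (X i) - X i := by
    intro i
    have := map_dvd (φ h⁻¹) (hdvd (e i))
    rw [map_sub, hcomp, hcomp] at this
    simpa using this
  have hq' : Prime (φ h⁻¹ q) := by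
    refine comap_prime (φ h) (φ h⁻¹) (fun a => ?_) ?_
    · rw [hcomp]
      simp
    · rw [hcomp]
      simpa using hq
  suffices h⁻¹ * g ∈ H by simpa using H.mul_mem hh this
  by_cases htriv : ∀ i, φ (h⁻¹ * g) (X i) - X i = 0
  · have : h⁻¹ * g = 1 := by
      refine hinj (MvPolynomial.algHom_ext fun i => ?_)
      rw [sub_eq_zero.1 (htriv i)]
      simp
    rw [this]
    exact H.one_mem
  · push Not at htriv
    obtain ⟨i₀, hi₀⟩ := htriv
    refine hH _ ⟨i₀, fun i => ?_⟩
    exact exists_eq_smul_of_prime_dvd hq' ((hφ _ _).sub (isHomogeneous_X _ _))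
      ((hφ _ _).sub (isHomogeneous_X _ _)) hi₀ (hdvd' i₀) (hdvd' i)

/-- If the transfer ideal is principal, an abelian `p`-group acting linearly is generated by its
reflections. -/
theorem eq_top_of_isReflection_mem [Fintype ι] [Fintype Γ] (p : ℕ) [Fact p.Prime] [CharP k p]
    (hp : IsPGroup p Γ) (hcomm : ∀ g h : Γ, g * h = h * g)
    {φ : Γ →* (MvPolynomial ι k →ₐ[k] MvPolynomial ι k)} (hφ : IsLinearAction φ)
    (hinj : Function.Injective φ) (H : Subgroup Γ) (hH : ∀ σ, IsReflection φ σ → σ ∈ H)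
    {d : MvPolynomial ι k} (hdinv : ∀ g, φ g d = d) (hdim : ∃ a, ∑ g, φ g a = d)
    (hd : ∀ a, d ∣ ∑ g, φ g a) : H = ⊤ := by
  classical
  have hd0 : d ≠ 0 := by
    rintro rfl
    obtain ⟨a, ha⟩ := exists_sum_ne_zero φ hinj
    exact ha (zero_dvd_iff.1 (hd a))
  refine eq_top_of_dvd_sum_subgroup p hp φ (aeval 0) (fun g a => ?_) H hd0 hdinv hdim
    (dvd_sum_subgroup_of_dvd_sum hcomm φ H hd0 hd fun q hq g hg =>
      exists_not_dvd_sub_of_notMem hφ hinj H hH hq hg)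
  simpa [constantCoeff_eq] using hφ.coeff_zero g a

end LinearAction

end InvariantTheory

end


noncomputable section

namespace InvariantTheory

/-! ### Graded direct summands of polynomial rings -/

section GradedSubalgebra

open MvPolynomial

variable {k ι κ : Type*} [Field k]

theorem homogeneousComponent_mul_of_isHomogeneous {x : MvPolynomial ι k} {n : ℕ}
    (hx : x.IsHomogeneous n) (c : MvPolynomial ι k) (d : ℕ) :
    homogeneousComponent d (x * c) = if n ≤ d then x * homogeneousComponent (d - n) c else 0 := by
  conv_lhs => rw [← sum_homogeneousComponent c]
  rw [Finset.mul_sum, map_sum]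
  have : ∀ i, homogeneousComponent d (x * homogeneousComponent i c) =
      if n + i = d then x * homogeneousComponent i c else 0 := by
    intro i
    rw [homogeneousComponent_of_mem (hx.mul (homogeneousComponent_isHomogeneous i c))]
    split_ifs with h1 h2 h2
    · rfl
    · exact absurd h1.symm h2
    · exact absurd h2.symm h1
    · rfl
  simp only [this]
  split_ifs with h
  · have h' : ∀ i, (n + i = d ↔ i = d - n) := fun i => by omega
    simp only [h', Finset.sum_ite_eq', Finset.mem_range]
    split_ifs with h2
    · rfl
    · rw [homogeneousComponent_eq_zero _ _ (by omega), mul_zero]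
  · exact Finset.sum_eq_zero fun i _ => if_neg (by omega)

/-- A subalgebra of a polynomial ring is graded if it contains the homogeneous components of its
elements. -/
def IsGradedSubalgebra (R : Subalgebra k (MvPolynomial ι k)) : Prop :=
  ∀ f ∈ R, ∀ d, homogeneousComponent d f ∈ R

/-- `R` is a direct summand of the polynomial ring as an `R`-module. -/
def HasRetraction (R : Subalgebra k (MvPolynomial ι k)) : Prop :=
  ∃ ρ : MvPolynomial ι k →ₗ[k] MvPolynomial ι k, (∀ a, ρ a ∈ R) ∧ ρ 1 = 1 ∧
    ∀ b ∈ R, ∀ a, ρ (b * a) = b * ρ a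

/-- `R` is generated by at most `r` homogeneous elements. -/
def IsGeneratedByHomogeneous (R : Subalgebra k (MvPolynomial ι k)) (r : ℕ) : Prop :=
  ∃ s : Finset (MvPolynomial ι k), s.card ≤ r ∧ (∀ f ∈ s, ∃ d, f.IsHomogeneous d) ∧
    Algebra.adjoin k (s : Set (MvPolynomial ι k)) = R

theorem isGradedSubalgebra_adjoin {s : Set (MvPolynomial ι k)}
    (hs : ∀ f ∈ s, ∃ d, f.IsHomogeneous d) : IsGradedSubalgebra (Algebra.adjoin k s) := by
  intro f hf
  induction hf using Algebra.adjoin_induction with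
  | mem x hx =>
    intro d
    obtain ⟨n, hn⟩ := hs x hx
    rw [homogeneousComponent_of_mem hn]
    split_ifs
    · exact Algebra.subset_adjoin hx
    · exact zero_mem _
  | algebraMap r =>
    intro d
    rw [MvPolynomial.algebraMap_eq, homogeneousComponent_of_mem (isHomogeneous_C ι r)]
    split_ifs
    · exact (Algebra.adjoin k s).algebraMap_mem r
    · exact zero_mem _
  | add x y _ _ hx hy =>
    intro d
    rw [map_add]
    exact add_mem (hx d) (hy d)
  | mul x y _ _ hx hy =>
    intro d
    rw [← sum_homogeneousComponent x, Finset.sum_mul, map_sum]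
    refine sum_mem fun i _ => ?_
    rw [homogeneousComponent_mul_of_isHomogeneous (homogeneousComponent_isHomogeneous i x)]
    split_ifs
    · exact mul_mem (hx _) (hy _)
    · exact zero_mem _

/-! ### Passing to the quotient by invariant linear forms, and lifting generators back -/

section Lift

variable {ψ : MvPolynomial ι k →ₐ[k] MvPolynomial κ k} {B : Subalgebra k (MvPolynomial ι k)}

theorem IsGradedSubalgebra.map (hψ : ∀ i, (ψ (X i)).IsHomogeneous 1)
    (hB : IsGradedSubalgebra B) : IsGradedSubalgebra (B.map ψ) := by
  rintro _ ⟨b, hb, rfl⟩ d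
  have := homogeneousComponent_algHom_apply hψ b d
  exact ⟨homogeneousComponent d b, hB b hb d, this.symm⟩

/-- The kernel of ψ is generated by elements of B, so the B-linear ρ preserves it and descends. The
section s only serves to choose preimages. -/
theorem HasRetraction.map (hB : HasRetraction B) {x : Set (MvPolynomial ι k)} (hxB : x ⊆ B)
    (hx0 : ∀ f ∈ x, ψ f = 0) (hker : ∀ a, ψ a = 0 → a ∈ Ideal.span x)
    (s : MvPolynomial κ k →ₐ[k] MvPolynomial ι k) (hs : ∀ y, ψ (s y) = y) :
    HasRetraction (B.map ψ) := by
  obtain ⟨ρ, hρB, hρ1, hρ⟩ := hB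
  have hρ0 : ∀ a, ψ a = 0 → ψ (ρ a) = 0 := by
    intro a ha
    have := hker a ha
    rw [Ideal.span, Submodule.mem_span_set'] at this
    obtain ⟨n, f, g, rfl⟩ := this
    rw [map_sum, map_sum]
    refine Finset.sum_eq_zero fun i _ => ?_
    rw [smul_eq_mul, mul_comm, hρ _ (hxB (g i).2), map_mul, hx0 _ (g i).2, zero_mul]
  refine ⟨ψ.toLinearMap ∘ₗ ρ ∘ₗ s.toLinearMap, fun a => ⟨ρ (s a), hρB _, rfl⟩, by simp [hρ1], ?_⟩
  rintro _ ⟨b, hb, rfl⟩ a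
  have h1 : ψ (ρ (s (ψ b * a) - b * s a)) = 0 := hρ0 _ (by simp [hs])
  rw [map_sub, map_sub, sub_eq_zero, hρ b hb, map_mul ψ] at h1
  simpa using h1

/-- Graded Nakayama. An element of B killed by ψ is a combination of the x with coefficients in the
big ring; the retraction moves these coefficients into B, and they have smaller degree. -/
theorem IsGeneratedByHomogeneous.of_map (hψ : ∀ i, (ψ (X i)).IsHomogeneous 1)
    (hgr : IsGradedSubalgebra B) (hB : HasRetraction B) {x : Finset (MvPolynomial ι k)}
    (hxB : ∀ f ∈ x, f ∈ B) (hx1 : ∀ f ∈ x, f.IsHomogeneous 1)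
    (hker : ∀ a, ψ a = 0 → a ∈ Ideal.span (x : Set (MvPolynomial ι k))) {r : ℕ}
    (h : IsGeneratedByHomogeneous (B.map ψ) r) : IsGeneratedByHomogeneous B (x.card + r) := by
  classical
  obtain ⟨s, hsr, hsh, hs⟩ := h
  have hlift : ∀ f : MvPolynomial κ k, ∃ F, f ∈ s → F ∈ B ∧ ψ F = f ∧ ∃ d, F.IsHomogeneous d := by
    intro f
    by_cases hf : f ∈ s
    · obtain ⟨d, hd⟩ := hsh f hf
      have : f ∈ B.map ψ := hs ▸ Algebra.subset_adjoin hf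
      obtain ⟨b, hb, rfl⟩ := this
      refine ⟨homogeneousComponent d b, fun _ => ⟨hgr b hb d, ?_, d,
        homogeneousComponent_isHomogeneous d b⟩⟩
      rw [← homogeneousComponent_algHom_apply hψ]
      have : homogeneousComponent d (ψ b) = ψ b := homogeneousComponent_eq_self hd
      exact this
    · exact ⟨0, fun h => absurd h hf⟩
  choose F hF using hlift
  obtain ⟨ρ, hρB, hρ1, hρ⟩ := hB
  let t := x ∪ s.image F
  have hth : ∀ f ∈ t, ∃ d, f.IsHomogeneous d := by
    intro f hf
    rcases Finset.mem_union.1 hf with h | h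
    · exact ⟨1, hx1 f h⟩
    · obtain ⟨g, hg, rfl⟩ := Finset.mem_image.1 h
      exact (hF g hg).2.2
  have htB : Algebra.adjoin k (t : Set (MvPolynomial ι k)) ≤ B := by
    rw [Algebra.adjoin_le_iff]
    intro f hf
    rcases Finset.mem_union.1 (Finset.mem_coe.1 hf) with h | h
    · exact hxB f h
    · obtain ⟨g, hg, rfl⟩ := Finset.mem_image.1 h
      exact (hF g hg).1
  have htgr := isGradedSubalgebra_adjoin (k := k) (s := (t : Set (MvPolynomial ι k))) hth
  have key : ∀ d, ∀ b ∈ B, b.IsHomogeneous d →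
      b ∈ Algebra.adjoin k (t : Set (MvPolynomial ι k)) := by
    intro d
    induction d using Nat.strong_induction_on with
    | _ d ih =>
      intro b hb hbd
      have h1 : ψ b ∈ (Algebra.adjoin k (t : Set (MvPolynomial ι k))).map ψ := by
        have h2 : ψ b ∈ B.map ψ := ⟨b, hb, rfl⟩
        rw [← hs] at h2
        refine Algebra.adjoin_le ?_ h2
        intro f hf
        exact ⟨F f, Algebra.subset_adjoin (Finset.mem_coe.2 (Finset.mem_union_right _
          (Finset.mem_image_of_mem _ hf))), (hF f hf).2.1⟩
      obtain ⟨P, hP, hPb⟩ := h1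
      have h3 : b - P ∈ Ideal.span (x : Set (MvPolynomial ι k)) := by
        refine hker _ ?_
        rw [map_sub, sub_eq_zero]
        exact hPb.symm
      rw [Ideal.span, Submodule.mem_span_set'] at h3
      obtain ⟨n, f, g, hfg⟩ := h3
      have hbP : b - P ∈ B := sub_mem hb (htB hP)
      -- `b - P` lies in B, so ρ fixes it; applying ρ to the relation replaces each `f i` by an
      -- element of B.
      have h4 : b - P = ∑ i, (g i : MvPolynomial ι k) * ρ (f i) := by
        have := hρ _ hbP 1
        rw [mul_one, hρ1, mul_one] at this
        rw [← this, ← hfg, map_sum]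
        refine Finset.sum_congr rfl fun i _ => ?_
        rw [smul_eq_mul, mul_comm, hρ _ (hxB _ (g i).2)]
      have h5 : b = homogeneousComponent d P +
          ∑ i, homogeneousComponent d ((g i : MvPolynomial ι k) * ρ (f i)) := by
        rw [← map_sum, ← h4, ← map_add, add_sub_cancel]
        exact (homogeneousComponent_eq_self hbd).symm
      rw [h5]
      refine add_mem (htgr P hP d) (sum_mem fun i _ => ?_)
      rw [homogeneousComponent_mul_of_isHomogeneous (hx1 _ (g i).2)]
      split_ifs with hd
      · refine mul_mem (Algebra.subset_adjoin (Finset.mem_coe.2 (Finset.mem_union_left _ (g i).2)))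
          (ih (d - 1) (by omega) _ (hgr _ (hρB _) _) (homogeneousComponent_isHomogeneous _ _))
      · exact zero_mem _
  refine ⟨t, ?_, hth, le_antisymm htB fun b hb => ?_⟩
  · calc t.card ≤ x.card + (s.image F).card := Finset.card_union_le _ _
      _ ≤ x.card + r := by
        have := Finset.card_image_le (s := s) (f := F)
        omega
  · rw [← sum_homogeneousComponent b]
    exact sum_mem fun d _ => key d _ (hgr b hb d) (homogeneousComponent_isHomogeneous d b)

end Lift

/-! ### Translations and derivatives -/

section Translation

open TensorProduct

variable (k ι) in
/-- The comultiplication `f(y) ↦ f(y + z)`. -/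
def comulHom : MvPolynomial ι k →ₐ[k] MvPolynomial ι k ⊗[k] MvPolynomial ι k :=
  aeval fun i => X i ⊗ₜ 1 + 1 ⊗ₜ X i

/-- Contraction of the second tensor factor with a linear functional. -/
def contractRight {A Y : Type*} [AddCommGroup A] [Module k A] [AddCommGroup Y] [Module k Y]
    (l : Module.Dual k Y) : A ⊗[k] Y →ₗ[k] A :=
  (TensorProduct.rid k A).toLinearMap ∘ₗ LinearMap.lTensor A l

@[simp]
theorem contractRight_tmul {A Y : Type*} [AddCommGroup A] [Module k A] [AddCommGroup Y]
    [Module k Y] (l : Module.Dual k Y) (a : A) (y : Y) :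
    contractRight l (a ⊗ₜ[k] y) = l y • a := by
  simp [contractRight]

/-- `R` is stable under translations, i.e. a subcomodule. -/
def IsTranslationStable (R : Subalgebra k (MvPolynomial ι k)) : Prop :=
  ∀ l : Module.Dual k (MvPolynomial ι k), ∀ f ∈ R, contractRight l (comulHom k ι f) ∈ R

/-- It is enough that the translations of the target lift to a coaction on the source preserving B;
the source need not have translations in all its own variables. -/
theorem IsTranslationStable.map_of_coaction {A : Type*} [CommRing A] [Algebra k A]
    {ψ : A →ₐ[k] MvPolynomial κ k} {B : Subalgebra k A} (T : A →ₐ[k] A ⊗[k] MvPolynomial κ k)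
    (hT : ∀ a, Algebra.TensorProduct.map ψ (AlgHom.id k _) (T a) = comulHom k κ (ψ a))
    (hB : ∀ l : Module.Dual k (MvPolynomial κ k), ∀ b ∈ B, contractRight l (T b) ∈ B) :
    IsTranslationStable (B.map ψ) := by
  rintro l _ ⟨b, hb, rfl⟩
  refine ⟨contractRight l (T b), hB l b hb, ?_⟩
  have : ∀ z, ψ (contractRight l z) =
      contractRight l (Algebra.TensorProduct.map ψ (AlgHom.id k (MvPolynomial κ k)) z) := by
    intro z
    induction z with
    | zero => simp
    | tmul a y => simp
    | add a b ha hb => simp only [map_add, ha, hb]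
  exact (this _).trans (congrArg _ (hT b))

theorem comulHom_map {ψ : MvPolynomial ι k →ₐ[k] MvPolynomial κ k}
    (h : ∀ i, comulHom k κ (ψ (X i)) = ψ (X i) ⊗ₜ[k] 1 + 1 ⊗ₜ[k] ψ (X i)) (f : MvPolynomial ι k) :
    Algebra.TensorProduct.map ψ ψ (comulHom k ι f) = comulHom k κ (ψ f) := by
  have : (Algebra.TensorProduct.map ψ ψ).comp (comulHom k ι) = (comulHom k κ).comp ψ := by
    refine MvPolynomial.algHom_ext fun i => ?_
    rw [AlgHom.comp_apply, AlgHom.comp_apply, h]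
    simp [comulHom]
  exact DFunLike.congr_fun this f

theorem IsTranslationStable.map {ψ : MvPolynomial ι k →ₐ[k] MvPolynomial κ k}
    (h : ∀ i, comulHom k κ (ψ (X i)) = ψ (X i) ⊗ₜ[k] 1 + 1 ⊗ₜ[k] ψ (X i))
    {R : Subalgebra k (MvPolynomial ι k)} (hR : IsTranslationStable R) :
    IsTranslationStable (R.map ψ) := by
  refine IsTranslationStable.map_of_coaction
    ((Algebra.TensorProduct.map (AlgHom.id k _) ψ).comp (comulHom k ι)) (fun a => ?_) fun l b hb => ?_
  · rw [← comulHom_map h, AlgHom.comp_apply, ← AlgHom.comp_apply,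
      ← Algebra.TensorProduct.map_comp]
    simp
  · have : ∀ z, contractRight l (Algebra.TensorProduct.map
        (AlgHom.id k (MvPolynomial ι k)) ψ z) = contractRight (l ∘ₗ ψ.toLinearMap) z := by
      intro z
      induction z with
      | zero => simp
      | tmul a y => simp
      | add a b ha hb => simp only [map_add, ha, hb]
    rw [AlgHom.comp_apply, this]
    exact hR _ b hb

/-- Taylor expansion to first order: the part of f(y + z) linear in y_i is y_i times ∂f/∂z_i. -/
theorem coeff_single_contractRight_comulHom (i : ι) (m : ι →₀ ℕ) (f : MvPolynomial ι k) :
    coeff (Finsupp.single i 1) (contractRight (lcoeff k m) (comulHom k ι f)) =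
      coeff m (pderiv i f) := by
  classical
  -- `E₀` sets y = 0 and `E` takes the coefficient of y_i. On f(y + z), `E` obeys the recursion of
  -- the product rule under multiplication by a variable.
  let E₀ : MvPolynomial ι k ⊗[k] MvPolynomial ι k →ₐ[k] MvPolynomial ι k :=
    Algebra.TensorProduct.lift (aeval 0) (AlgHom.id k _) fun _ _ => Commute.all _ _
  have hz : ∀ a : MvPolynomial ι k, (aeval (0 : ι → MvPolynomial ι k)) a = C (coeff 0 a) := by
    intro a
    rw [aeval_zero, constantCoeff_eq, MvPolynomial.algebraMap_eq]
  let E : MvPolynomial ι k ⊗[k] MvPolynomial ι k →ₗ[k] MvPolynomial ι k :=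
    (TensorProduct.lid k _).toLinearMap ∘ₗ
      LinearMap.rTensor _ (lcoeff k (Finsupp.single i 1))
  have hE₀ : ∀ f : MvPolynomial ι k, E₀ (comulHom k ι f) = f := by
    intro f
    have : E₀.comp (comulHom k ι) = AlgHom.id k (MvPolynomial ι k) := by
      refine MvPolynomial.algHom_ext fun i => ?_
      simp [E₀, comulHom]
    exact DFunLike.congr_fun this f
  have hEX : ∀ j z, E (z * (X j ⊗ₜ 1)) = if i = j then E₀ z else 0 := by
    intro j z
    induction z with
    | zero => simp
    | tmul a b =>
      simp only [E, E₀, Algebra.TensorProduct.tmul_mul_tmul, mul_one, LinearMap.comp_apply,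
        LinearMap.rTensor_tmul, lcoeff_apply, LinearEquiv.coe_coe, TensorProduct.lid_tmul,
        Algebra.TensorProduct.lift_tmul, coeff_mul_X', hz]
      by_cases h : i = j
      · subst h
        simp [smul_eq_C_mul]
      · simp [h, Ne.symm h]
    | add a b ha hb =>
      rw [add_mul, map_add, map_add, ha, hb]
      split_ifs <;> simp
  have hEY : ∀ j z, E (z * (1 ⊗ₜ X j)) = E z * X j := by
    intro j z
    induction z with
    | zero => simp
    | tmul a b => simp [E]
    | add a b ha hb => rw [add_mul, map_add, map_add, ha, hb, add_mul]
  have hEd : E (comulHom k ι f) = pderiv i f := by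
    induction f using MvPolynomial.induction_on with
    | C a =>
      rw [algHom_C, pderiv_C, Algebra.TensorProduct.algebraMap_apply]
      have h0 : (0 : ι →₀ ℕ) ≠ Finsupp.single i 1 := by simp [eq_comm]
      simp [E, MvPolynomial.algebraMap_eq, coeff_C, h0]
    | add f g hf hg => simp only [map_add, hf, hg]
    | mul_X f j hf =>
      have : comulHom k ι (X j : MvPolynomial ι k) = X j ⊗ₜ 1 + 1 ⊗ₜ X j := by simp [comulHom]
      rw [map_mul, this, mul_add, map_add, hEX, hEY, hf, hE₀, pderiv_mul, pderiv_X]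
      by_cases h : i = j
      · subst h
        simp [add_comm]
      · simp [h, Ne.symm h]
  rw [← hEd]
  generalize comulHom k ι f = z
  induction z with
  | zero => simp
  | tmul a b => simp [E, mul_comm]
  | add a b ha hb => simp only [map_add, coeff_add, ha, hb]

/-- Contracting f(y + z) against z^m stays in R, and so does the linear part of the result, whose
coefficients are those of the derivatives of f at z^m. Without linear forms in R they all vanish. -/
theorem IsTranslationStable.pderiv_eq_zero {R : Subalgebra k (MvPolynomial ι k)}
    (hR : IsTranslationStable R) (hgr : IsGradedSubalgebra R)
    (h1 : ∀ l ∈ R, l.IsHomogeneous 1 → l = 0) {f : MvPolynomial ι k} (hf : f ∈ R) (i : ι) :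
    pderiv i f = 0 := by
  ext m
  rw [← coeff_single_contractRight_comulHom]
  have := h1 _ (hgr _ (hR (lcoeff k m) f hf) 1) (homogeneousComponent_isHomogeneous _ _)
  have h2 := congrArg (coeff (Finsupp.single i 1)) this
  rw [coeff_homogeneousComponent, if_pos (by simp)] at h2
  rw [h2, coeff_zero, coeff_zero]

end Translation

end GradedSubalgebra

end InvariantTheory

end


noncomputable section

namespace InvariantTheory

/-! ### Removing p-th powers of the variables -/

section Frobenius

open MvPolynomial TensorProduct

variable {k ι : Type*} [Field k]

/-- A nonzero coefficient at m forces m i = 0 in k for every i. As `expand p` raises only the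
variables to the p-th power, no roots of coefficients are needed and k may be imperfect. -/
theorem exists_expand_eq_of_pderiv_eq_zero (p : ℕ) [Fact p.Prime] [CharP k p]
    {f : MvPolynomial ι k} (hf : ∀ i, pderiv i f = 0) : ∃ g, expand p g = f := by
  classical
  have hdvd : ∀ m ∈ f.support, ∀ i, p ∣ m i := by
    intro m hm i
    by_contra hi
    have h0 : m i ≠ 0 := fun h => hi (h ▸ dvd_zero p)
    have h1 := congrArg (coeff (m - Finsupp.single i 1)) (hf i)
    rw [coeff_pderiv, coeff_zero] at h1
    have h2 : m - Finsupp.single i 1 + Finsupp.single i 1 = m :=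
      tsub_add_cancel_of_le (by simpa [Nat.one_le_iff_ne_zero] using h0)
    rw [h2] at h1
    have h3 : (((m - Finsupp.single i 1 : ι →₀ ℕ) i : ℕ) : k) + 1 = (m i : k) := by
      have : (m - Finsupp.single i 1 : ι →₀ ℕ) i + 1 = m i := by
        simp
        omega
      exact_mod_cast congrArg (Nat.cast : ℕ → k) this
    rw [h3] at h1
    rcases mul_eq_zero.1 h1 with h | h
    · exact (mem_support_iff.1 hm) h
    · exact hi ((CharP.cast_eq_zero_iff k p _).1 h)
  refine ⟨∑ m ∈ f.support, monomial (m.mapRange (· / p) (Nat.zero_div p)) (coeff m f), ?_⟩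
  conv_rhs => rw [f.as_sum]
  rw [map_sum]
  refine Finset.sum_congr rfl fun m hm => ?_
  rw [expand_monomial]
  have : p • m.mapRange (· / p) (Nat.zero_div p) = m :=
    Finsupp.ext fun i => by simpa using Nat.mul_div_cancel' (hdvd m hm i)
  rw [this]

theorem isHomogeneous_expand {p d : ℕ} {f : MvPolynomial ι k} (hf : f.IsHomogeneous d) :
    (expand p f).IsHomogeneous (p * d) := by
  have : expand p f = aeval (fun i => (X i : MvPolynomial ι k) ^ p) f := rfl
  rw [this]
  refine hf.aeval _ fun i => ?_
  exact isHomogeneous_X_pow i p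

theorem homogeneousComponent_expand {p : ℕ} (hp : 0 < p) (f : MvPolynomial ι k) (d : ℕ) :
    homogeneousComponent (p * d) (expand p f) = expand p (homogeneousComponent d f) := by
  conv_lhs => rw [← sum_homogeneousComponent f]
  rw [map_sum, map_sum]
  have : ∀ i, homogeneousComponent (p * d) (expand p (homogeneousComponent i f)) =
      if i = d then expand p (homogeneousComponent d f) else 0 := by
    intro i
    rw [homogeneousComponent_of_mem
      (isHomogeneous_expand (homogeneousComponent_isHomogeneous i f))]
    split_ifs with h1 h2 h2
    · rw [h2]
    · exact absurd (Nat.eq_of_mul_eq_mul_left hp h1).symm h2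
    · exact absurd (by rw [h2]) h1
    · rfl
  simp only [this, Finset.sum_ite_eq', Finset.mem_range]
  split_ifs with h
  · rfl
  · rw [homogeneousComponent_eq_zero _ _ (by omega), map_zero]

/-- On variables this is (y + z)^p = y^p + z^p. -/
theorem comulHom_expand (p : ℕ) [Fact p.Prime] [CharP k p] (f : MvPolynomial ι k) :
    comulHom k ι (expand p f) =
      Algebra.TensorProduct.map (expand p) (expand p) (comulHom k ι f) := by
  have hchar : CharP (MvPolynomial ι k ⊗[k] MvPolynomial ι k) p :=
    charP_of_injective_algebraMap (algebraMap k _).injective p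
  have : (comulHom k ι).comp (expand p) =
      (Algebra.TensorProduct.map (expand p) (expand p)).comp (comulHom k ι) := by
    refine MvPolynomial.algHom_ext fun i => ?_
    have : ExpChar (MvPolynomial ι k ⊗[k] MvPolynomial ι k) p := ExpChar.prime Fact.out
    simp [comulHom, add_pow_expChar]
  exact DFunLike.congr_fun this f

variable {R : Subalgebra k (MvPolynomial ι k)}

theorem IsGradedSubalgebra.comap_expand {p : ℕ} (hp : 0 < p) (hR : IsGradedSubalgebra R) :
    IsGradedSubalgebra (R.comap (expand p)) := by
  intro f hf d
  have hf' : expand p f ∈ R := hf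
  have := hR _ hf' (p * d)
  rwa [homogeneousComponent_expand hp] at this

theorem exists_leftInverse_expand {p : ℕ} (hp : 0 < p) :
    ∃ g : MvPolynomial ι k →ₗ[k] MvPolynomial ι k, ∀ f, g (expand p f) = f := by
  obtain ⟨g, hg⟩ := LinearMap.exists_leftInverse_of_injective
    ((expand p).toLinearMap : MvPolynomial ι k →ₗ[k] MvPolynomial ι k)
    (LinearMap.ker_eq_bot.2 (expand_injective hp))
  exact ⟨g, fun f => DFunLike.congr_fun hg f⟩

/-- The retraction takes values in R, hence in the image of `expand p`, and can be pulled back by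
any linear left inverse. -/
theorem HasRetraction.comap_expand {p : ℕ} (hp : 0 < p) (hR : HasRetraction R)
    (hexp : ∀ f ∈ R, ∃ g, expand p g = f) : HasRetraction (R.comap (expand p)) := by
  obtain ⟨ρ, hρR, hρ1, hρ⟩ := hR
  obtain ⟨g, hg⟩ := exists_leftInverse_expand (k := k) (ι := ι) hp
  have hg' : ∀ f ∈ R, expand p (g f) = f := by
    intro f hf
    obtain ⟨u, rfl⟩ := hexp f hf
    rw [hg]
  refine ⟨g ∘ₗ ρ ∘ₗ (expand p).toLinearMap, fun a => ?_, ?_, fun b hb a => ?_⟩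
  · change expand p (g (ρ (expand p a))) ∈ R
    rw [hg' _ (hρR _)]
    exact hρR _
  · have : g (1 : MvPolynomial ι k) = 1 := by
      have := hg 1
      rwa [map_one] at this
    simp [hρ1, this]
  · refine expand_injective hp ?_
    have hb' : expand p b ∈ R := hb
    simp only [LinearMap.comp_apply, AlgHom.toLinearMap_apply, map_mul]
    rw [hg' _ (hρR _), hg' _ (hρR _), hρ _ hb']

theorem IsTranslationStable.comap_expand (p : ℕ) [Fact p.Prime] [CharP k p]
    (hR : IsTranslationStable R) : IsTranslationStable (R.comap (expand p)) := by
  intro l f hf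
  obtain ⟨g, hg⟩ := exists_leftInverse_expand (k := k) (ι := ι) (p := p) (Fact.out : p.Prime).pos
  have hf' : expand p f ∈ R := hf
  -- `l ∘ₗ g` extends l along the injection `expand p`.
  have := hR (l ∘ₗ g) _ hf'
  change expand p (contractRight l (comulHom k ι f)) ∈ R
  convert this using 1
  rw [comulHom_expand]
  generalize comulHom k ι f = z
  induction z with
  | zero => simp
  | tmul a b => simp [hg]
  | add a b ha hb => simp only [map_add, ha, hb]

theorem IsGeneratedByHomogeneous.of_comap_expand {p r : ℕ}
    (hexp : ∀ f ∈ R, ∃ g, expand p g = f) (h : IsGeneratedByHomogeneous (R.comap (expand p)) r) :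
    IsGeneratedByHomogeneous R r := by
  classical
  obtain ⟨s, hsr, hsh, hs⟩ := h
  refine ⟨s.image (expand p), Finset.card_image_le.trans hsr, fun f hf => ?_, ?_⟩
  · obtain ⟨g, hg, rfl⟩ := Finset.mem_image.1 hf
    obtain ⟨d, hd⟩ := hsh g hg
    exact ⟨p * d, isHomogeneous_expand hd⟩
  · rw [Finset.coe_image, ← AlgHom.map_adjoin, hs]
    ext f
    constructor
    · rintro ⟨g, hg, rfl⟩
      exact hg
    · intro hf
      obtain ⟨g, rfl⟩ := hexp f hf
      exact ⟨g, hf, rfl⟩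

end Frobenius

/-! ### Translation stable direct summands have few generators -/

section Structure

open MvPolynomial TensorProduct

variable {k : Type*} [Field k]

theorem eq_sum_smul_X_of_isHomogeneous_one {ι : Type*} [Fintype ι] {l : MvPolynomial ι k}
    (hl : l.IsHomogeneous 1) : l = ∑ i, coeff (Finsupp.single i 1) l • X i := by
  classical
  have : l ∈ homogeneousSubmodule ι k 1 := hl
  rw [homogeneousSubmodule_one_eq_span_X, Submodule.mem_span_range_iff_exists_fun] at this
  obtain ⟨c, hc⟩ := this
  rw [← hc]
  refine Finset.sum_congr rfl fun i _ => ?_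
  congr 1
  simp [coeff_sum, coeff_X, Finsupp.single_left_inj]

/-- Eliminating a variable by means of a nonzero linear form. -/
theorem exists_elimination {r : ℕ} {l : MvPolynomial (Fin (r + 1)) k} (hl : l.IsHomogeneous 1)
    (hl0 : l ≠ 0) :
    ∃ (ψ : MvPolynomial (Fin (r + 1)) k →ₐ[k] MvPolynomial (Fin r) k)
      (s : MvPolynomial (Fin r) k →ₐ[k] MvPolynomial (Fin (r + 1)) k),
      (∀ y, ψ (s y) = y) ∧ ψ l = 0 ∧ (∀ a, ψ a = 0 → a ∈ Ideal.span {l}) ∧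
      (∀ i, (ψ (X i)).IsHomogeneous 1) ∧ ∀ j, ∃ i, ψ (X i) = X j := by
  classical
  obtain ⟨c, hc⟩ : ∃ c : Fin (r + 1) → k, l = ∑ i, c i • X i :=
    ⟨_, eq_sum_smul_X_of_isHomogeneous_one hl⟩
  obtain ⟨i₀, hi₀⟩ : ∃ i, c i ≠ 0 := by
    by_contra! h
    exact hl0 (by rw [hc]; simp [h])
  let ψ : MvPolynomial (Fin (r + 1)) k →ₐ[k] MvPolynomial (Fin r) k :=
    aeval (i₀.insertNth (-∑ j, ((c i₀)⁻¹ * c (i₀.succAbove j)) • (X j : MvPolynomial (Fin r) k)) X)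
  let s : MvPolynomial (Fin r) k →ₐ[k] MvPolynomial (Fin (r + 1)) k := rename i₀.succAbove
  have hψ0 : ψ (X i₀) = -∑ j, ((c i₀)⁻¹ * c (i₀.succAbove j)) • X j := by simp [ψ]
  have hψ1 : ∀ j, ψ (X (i₀.succAbove j)) = X j := by simp [ψ]
  have hl' : l = c i₀ • X i₀ + ∑ j, c (i₀.succAbove j) • X (i₀.succAbove j) := by
    rw [hc, Fin.sum_univ_succAbove _ i₀]
  refine ⟨ψ, s, fun y => ?_, ?_, fun a ha => ?_, fun i => ?_, fun j => ⟨_, hψ1 j⟩⟩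
  · have : ψ.comp s = AlgHom.id k _ := by
      refine MvPolynomial.algHom_ext fun j => ?_
      simp [s, hψ1]
    exact DFunLike.congr_fun this y
  · rw [hl', map_add, map_smul, hψ0, map_sum, smul_neg, Finset.smul_sum]
    simp only [map_smul, hψ1, smul_smul, mul_inv_cancel_left₀ hi₀]
    simp
  · have : (Ideal.Quotient.mkₐ k (Ideal.span {l})).comp (s.comp ψ) =
        Ideal.Quotient.mkₐ k (Ideal.span {l}) := by
      refine MvPolynomial.algHom_ext fun i => ?_
      rcases Fin.eq_self_or_eq_succAbove i₀ i with rfl | ⟨j, rfl⟩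
      · rw [AlgHom.comp_apply, AlgHom.comp_apply, hψ0, Ideal.Quotient.mkₐ_eq_mk,
          Ideal.Quotient.eq]
        have : s (-∑ j, ((c i)⁻¹ * c (i.succAbove j)) • X j) - X i = C (-(c i)⁻¹) * l := by
          rw [← smul_eq_C_mul, hl', smul_add, smul_smul, Finset.smul_sum, map_neg, map_sum]
          simp only [map_smul, smul_smul, s, rename_X]
          simp only [neg_mul, inv_mul_cancel₀ hi₀, neg_smul, one_smul, Finset.sum_neg_distrib]
          ring
        rw [this]
        exact Ideal.mul_mem_left _ _ (Ideal.subset_span rfl)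
      · rw [AlgHom.comp_apply, AlgHom.comp_apply, hψ1]
        simp [s]
    have h1 := DFunLike.congr_fun this a
    rw [AlgHom.comp_apply, AlgHom.comp_apply, ha, map_zero, map_zero] at h1
    exact Ideal.Quotient.eq_zero_iff_mem.1 h1.symm
  · rcases Fin.eq_self_or_eq_succAbove i₀ i with rfl | ⟨j, rfl⟩
    · rw [hψ0]
      refine (IsHomogeneous.sum _ _ _ fun j _ => ?_).neg
      rw [smul_eq_C_mul]
      exact isHomogeneous_C_mul_X _ _
    · rw [hψ1]
      exact isHomogeneous_X _ _

theorem comulHom_of_isHomogeneous_one {ι : Type*} [Fintype ι] {l : MvPolynomial ι k}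
    (hl : l.IsHomogeneous 1) : comulHom k ι l = l ⊗ₜ[k] 1 + 1 ⊗ₜ[k] l := by
  rw [eq_sum_smul_X_of_isHomogeneous_one hl, map_sum, TensorProduct.sum_tmul,
    TensorProduct.tmul_sum, ← Finset.sum_add_distrib]
  refine Finset.sum_congr rfl fun i _ => ?_
  simp [comulHom, TensorProduct.smul_tmul']

/-- A graded, translation stable direct summand of a polynomial ring in `r` variables, containing
`p`-power powers of the variables, is generated by `r` homogeneous elements. -/
theorem isGeneratedByHomogeneous_of_isTranslationStable (p : ℕ) [Fact p.Prime] [CharP k p]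
    (N r : ℕ) (R : Subalgebra k (MvPolynomial (Fin r) k)) (hgr : IsGradedSubalgebra R)
    (hret : HasRetraction R) (htr : IsTranslationStable R) (hpow : ∀ i, X i ^ p ^ N ∈ R) :
    IsGeneratedByHomogeneous R r := by
  classical
  have hp : p.Prime := Fact.out
  induction N generalizing r with
  | zero =>
    refine ⟨Finset.univ.image X, Finset.card_image_le.trans (by simp), fun f hf => ?_, ?_⟩
    · obtain ⟨i, -, rfl⟩ := Finset.mem_image.1 hf
      exact ⟨1, isHomogeneous_X _ _⟩
    · have h1 : R = ⊤ := by
        rw [eq_top_iff, ← adjoin_range_X, Algebra.adjoin_le_iff]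
        rintro _ ⟨i, rfl⟩
        simpa using hpow i
      rw [h1, Finset.coe_image, Finset.coe_univ, Set.image_univ, adjoin_range_X]
  | succ N ihN =>
    induction r with
    | zero =>
      have hexp : ∀ f ∈ R, ∃ g, expand p g = f := fun f hf =>
        exists_expand_eq_of_pderiv_eq_zero p fun i => i.elim0
      exact .of_comap_expand hexp (ihN 0 _ (hgr.comap_expand hp.pos)
        (hret.comap_expand hp.pos hexp) (htr.comap_expand p) fun i => i.elim0)
    | succ r ihr =>
      -- A linear form in R is divided out, which lowers r and keeps N. Without one, R consists of
      -- polynomials in the X^p, and passing to the preimage under `expand p` lowers N and keeps r.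
      by_cases hlin : ∃ l ∈ R, l.IsHomogeneous 1 ∧ l ≠ 0
      · obtain ⟨l, hlR, hl1, hl0⟩ := hlin
        obtain ⟨ψ, s, hs, hψl, hker, hψ1, hψX⟩ := exists_elimination hl1 hl0
        have h1 := ihr (R.map ψ) (hgr.map hψ1)
          (hret.map (x := {l}) (by simpa using hlR) (by simpa using hψl) hker s hs)
          (htr.map fun i => comulHom_of_isHomogeneous_one (hψ1 i)) fun j => by
            obtain ⟨i, hi⟩ := hψX j
            refine ⟨_, hpow i, ?_⟩
            change ψ (X i ^ p ^ (N + 1)) = _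
            rw [map_pow, hi]
        have := h1.of_map hψ1 hgr hret (x := {l}) (by simpa using hlR) (by simpa using hl1)
          (by simpa using hker)
        exact ⟨this.choose, this.choose_spec.1.trans (by simp [add_comm]), this.choose_spec.2⟩
      · push Not at hlin
        have hexp : ∀ f ∈ R, ∃ g, expand p g = f := fun f hf =>
          exists_expand_eq_of_pderiv_eq_zero p fun i => htr.pderiv_eq_zero hgr hlin hf i
        refine .of_comap_expand hexp (ihN _ _ (hgr.comap_expand hp.pos)
          (hret.comap_expand hp.pos hexp) (htr.comap_expand p) fun i => ?_)
        change expand p (X i ^ p ^ N) ∈ R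
        rw [map_pow, expand_X, ← pow_mul, ← pow_succ']
        exact hpow i

end Structure

end InvariantTheory

end


noncomputable section

namespace InvariantTheory

/-! ### Invariant subalgebras and integrality -/

section FixedSubalgebra

variable {k A Γ : Type*} [Field k] [CommRing A] [Algebra k A] [Group Γ]

/-- The subalgebra of invariants of a group acting by algebra endomorphisms. -/
def fixedSubalgebra (φ : Γ →* (A →ₐ[k] A)) : Subalgebra k A where
  carrier := {f | ∀ g, φ g f = f}
  mul_mem' hf hg σ := by rw [map_mul, hf σ, hg σ]
  add_mem' hf hg σ := by rw [map_add, hf σ, hg σ]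
  algebraMap_mem' c σ := (φ σ).commutes c

variable {φ : Γ →* (A →ₐ[k] A)}

theorem sum_mem_fixedSubalgebra [Fintype Γ] (a : A) : ∑ g, φ g a ∈ fixedSubalgebra φ := by
  intro τ
  rw [map_sum]
  refine Fintype.sum_equiv (Equiv.mulLeft τ) _ _ fun g => ?_
  simp

theorem prod_mem_fixedSubalgebra [Fintype Γ] (a : A) : ∏ g, φ g a ∈ fixedSubalgebra φ := by
  intro τ
  rw [map_prod]
  refine Fintype.prod_equiv (Equiv.mulLeft τ) _ _ fun g => ?_
  simp

open Polynomial in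
/-- Every element is a simple root of a monic polynomial with invariant coefficients. -/
theorem exists_monic_aeval_eq_zero [IsDomain A] [Finite Γ] (φ : Γ →* (A →ₐ[k] A)) (a : A) :
    ∃ h : (fixedSubalgebra φ)[X], h.Monic ∧ aeval a h = 0 ∧ aeval a (derivative h) ≠ 0 := by
  classical
  have := Fintype.ofFinite Γ
  -- The orbit is taken as a set, without the multiplicities coming from a stabilizer, so that the
  -- roots are distinct and the derivative does not vanish at a.
  let O : Finset A := Finset.univ.image fun g => φ g a
  let P : A[X] := ∏ y ∈ O, (X - C y)
  have haO : a ∈ O := Finset.mem_image.2 ⟨1, Finset.mem_univ _, by simp⟩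
  have hPmonic : P.Monic := monic_prod_of_monic _ _ fun y _ => monic_X_sub_C y
  have hinj : ∀ g, Function.Injective (φ g) := by
    intro g x y hxy
    have := congrArg (φ g⁻¹) hxy
    simpa [← AlgHom.mul_apply, ← map_mul] using this
  have hPfix : ∀ g, P.map (φ g : A →+* A) = P := by
    intro g
    simp only [P, Polynomial.map_prod, Polynomial.map_sub, map_X, map_C]
    have hO : O.image (φ g) = O := by
      refine Finset.eq_of_subset_of_card_le (fun y hy => ?_)
        (by rw [Finset.card_image_of_injective _ (hinj g)])
      obtain ⟨z, hz, rfl⟩ := Finset.mem_image.1 hy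
      obtain ⟨h, -, rfl⟩ := Finset.mem_image.1 hz
      exact Finset.mem_image.2 ⟨g * h, Finset.mem_univ _, by simp⟩
    conv_rhs => rw [← hO]
    rw [Finset.prod_image fun x _ y _ hxy => hinj g hxy]
    rfl
  have hlift : P ∈ lifts (fixedSubalgebra φ).val.toRingHom := by
    rw [lifts_iff_coeff_lifts]
    intro n
    refine ⟨⟨P.coeff n, fun g => ?_⟩, rfl⟩
    have := congrArg (fun Q : A[X] => Q.coeff n) (hPfix g)
    simpa using this
  obtain ⟨h, hhP, -, hh⟩ := lifts_and_natDegree_eq_and_monic hlift hPmonic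
  have hmap : h.map (algebraMap (fixedSubalgebra φ) A) = P := hhP
  refine ⟨h, hh, ?_, ?_⟩
  · rw [aeval_def, ← eval_map, hmap, eval_prod]
    exact Finset.prod_eq_zero haO (by simp)
  · rw [aeval_def, ← eval_map, ← derivative_map, hmap]
    have hP : P = (X - C a) * ∏ y ∈ O.erase a, (X - C y) := (Finset.mul_prod_erase O _ haO).symm
    rw [hP]
    simp only [derivative_mul, derivative_sub, derivative_X, derivative_C, sub_zero, one_mul,
      eval_add, eval_mul, eval_sub, eval_X, eval_C, sub_self, zero_mul, add_zero, eval_prod]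
    rw [Finset.prod_ne_zero_iff]
    intro y hy
    exact sub_ne_zero.2 (Finset.ne_of_mem_erase hy).symm

theorem isIntegral_fixedSubalgebra [IsDomain A] [Finite Γ] (φ : Γ →* (A →ₐ[k] A)) :
    Algebra.IsIntegral (fixedSubalgebra φ) A :=
  ⟨fun a => by
    obtain ⟨h, hm, h0, -⟩ := exists_monic_aeval_eq_zero φ a
    exact ⟨h, hm, h0⟩⟩

end FixedSubalgebra

/-! ### From a bound on the number of generators to algebraic independence -/

section Coregular

open MvPolynomial

variable {k ι Γ : Type*} [Field k] [Group Γ] [Fintype ι]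

/-- A subalgebra generated by `n` algebraically independent homogeneous elements. -/
def IsPolynomialSubalgebra (B : Subalgebra k (MvPolynomial ι k)) (n : ℕ) : Prop :=
  ∃ f : Fin n → MvPolynomial ι k, (∀ i, ∃ d : ℕ, (f i).IsHomogeneous d) ∧
    AlgebraicIndependent k f ∧ Algebra.adjoin k (Set.range f) = B

/-- The polynomial ring is algebraic over B, so the generators contain a transcendence basis. It has
as many elements as there are variables, so no generator is left out. -/
theorem IsGeneratedByHomogeneous.isPolynomialSubalgebra {B : Subalgebra k (MvPolynomial ι k)}
    (hB : Algebra.IsIntegral B (MvPolynomial ι k))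
    (h : IsGeneratedByHomogeneous B (Fintype.card ι)) :
    IsPolynomialSubalgebra B (Fintype.card ι) := by
  classical
  obtain ⟨s, hcard, hs, rfl⟩ := h
  have halg : Algebra.IsAlgebraic (Algebra.adjoin k (s : Set (MvPolynomial ι k)))
    (MvPolynomial ι k) := Algebra.IsIntegral.isAlgebraic
  obtain ⟨t, hts, ht⟩ := exists_isTranscendenceBasis_subset (R := k) (s : Set (MvPolynomial ι k))
  have hc := (IsTranscendenceBasis.mvPolynomial ι k).lift_cardinalMk_eq ht
  have htfin : t.Finite := s.finite_toSet.subset hts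
  have htc : Fintype.card ι = htfin.toFinset.card := by
    have := htfin.fintype
    rw [Cardinal.mk_fintype, Cardinal.mk_fintype, Cardinal.lift_natCast, Cardinal.lift_natCast,
      Nat.cast_inj] at hc
    rw [hc, ← Set.toFinset_card, Set.Finite.toFinset_eq_toFinset]
  have hsub : htfin.toFinset ⊆ s := fun x hx => hts (by simpa using hx)
  have hst : htfin.toFinset = s := Finset.eq_of_subset_of_card_le hsub (htc ▸ hcard)
  have hts' : t = s := by rw [← hst]; simp
  subst hts'
  have hcs : s.card = Fintype.card ι := by rw [htc, hst]
  let e : Fin (Fintype.card ι) ≃ s := (finCongr hcs.symm).trans s.equivFin.symm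
  refine ⟨fun i => e i, fun i => hs _ (e i).2, ?_, ?_⟩
  · exact ht.1.comp e e.injective
  · congr 1
    ext x
    constructor
    · rintro ⟨i, rfl⟩
      exact (e i).2
    · intro hx
      exact ⟨e.symm ⟨x, hx⟩, by simp⟩

end Coregular

/-! ### Actions fixing x and moving y by linear forms in x -/

section Adapted

open MvPolynomial TensorProduct

variable {k Γ : Type*} [Field k] [Group Γ] {m r : ℕ}

theorem mem_span_X_inl_of_eq_zero {a : MvPolynomial (Fin m ⊕ Fin r) k}
    (ha : aeval (Sum.elim (0 : Fin m → MvPolynomial (Fin r) k) X) a = 0) :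
    a ∈ Ideal.span (Set.range fun i : Fin m => (X (Sum.inl i) : MvPolynomial (Fin m ⊕ Fin r) k)) := by
  set I := Ideal.span (Set.range fun i : Fin m => (X (Sum.inl i) : MvPolynomial (Fin m ⊕ Fin r) k))
  have : (Ideal.Quotient.mkₐ k I).comp ((rename Sum.inr).comp
      (aeval (Sum.elim (0 : Fin m → MvPolynomial (Fin r) k) X))) = Ideal.Quotient.mkₐ k I := by
    refine MvPolynomial.algHom_ext fun i => ?_
    rcases i with i | j
    · rw [AlgHom.comp_apply, AlgHom.comp_apply, aeval_X, Sum.elim_inl, Pi.zero_apply, map_zero,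
        map_zero, eq_comm]
      exact Ideal.Quotient.eq_zero_iff_mem.2 (Ideal.subset_span ⟨i, rfl⟩)
    · simp
  have h1 := DFunLike.congr_fun this a
  rw [AlgHom.comp_apply, AlgHom.comp_apply, ha, map_zero, map_zero] at h1
  exact Ideal.Quotient.eq_zero_iff_mem.1 h1.symm

/-- For an action `x ↦ x`, `y ↦ y + l(x)`, a direct summand of invariants is generated by as many
homogeneous elements as there are variables. -/
theorem isGeneratedByHomogeneous_fixedSubalgebra (p : ℕ) [Fact p.Prime] [CharP k p] [Fintype Γ]
    (hp : IsPGroup p Γ)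
    {φ : Γ →* (MvPolynomial (Fin m ⊕ Fin r) k →ₐ[k] MvPolynomial (Fin m ⊕ Fin r) k)}
    (hφ : IsLinearAction φ) (hx : ∀ g i, φ g (X (.inl i)) = X (.inl i))
    (hy : ∀ g j, ∃ l : MvPolynomial (Fin m) k, l.IsHomogeneous 1 ∧
      φ g (X (.inr j)) = X (.inr j) + rename Sum.inl l)
    (hret : HasRetraction (fixedSubalgebra φ)) :
    IsGeneratedByHomogeneous (fixedSubalgebra φ) (m + r) := by
  classical
  let ψ : MvPolynomial (Fin m ⊕ Fin r) k →ₐ[k] MvPolynomial (Fin r) k := aeval (Sum.elim 0 X)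
  have hψ1 : ∀ i, (ψ (X i)).IsHomogeneous 1 := by
    rintro (i | j)
    · simpa [ψ] using isHomogeneous_zero _ _ 1
    · simpa [ψ] using isHomogeneous_X _ _
  let x : Finset (MvPolynomial (Fin m ⊕ Fin r) k) := Finset.univ.image fun i => X (.inl i)
  have hx' : ∀ f ∈ x, ∃ i, f = X (.inl i) := by
    intro f hf
    obtain ⟨i, -, rfl⟩ := Finset.mem_image.1 hf
    exact ⟨i, rfl⟩
  have hxB : ∀ f ∈ x, f ∈ fixedSubalgebra φ := by
    intro f hf
    obtain ⟨i, rfl⟩ := hx' f hf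
    exact fun g => hx g i
  have hker : ∀ a, ψ a = 0 → a ∈ Ideal.span (x : Set (MvPolynomial (Fin m ⊕ Fin r) k)) := by
    intro a ha
    have := mem_span_X_inl_of_eq_zero ha
    simpa [x] using this
  have hgr : IsGradedSubalgebra (fixedSubalgebra φ) := by
    intro f hf d g
    rw [← homogeneousComponent_algHom_apply (hφ g), hf g]
  have hψl : ∀ l : MvPolynomial (Fin m) k, l.IsHomogeneous 1 → ψ (rename Sum.inl l) = 0 := by
    intro l hl
    rw [eq_sum_smul_X_of_isHomogeneous_one hl]
    simp [ψ]
  -- The coaction translating only the y's. It commutes with the group because φ g y - y involves x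
  -- alone; contractions of invariants are therefore invariant, and the image of B at x = 0 is
  -- translation stable.
  let T : MvPolynomial (Fin m ⊕ Fin r) k →ₐ[k]
      MvPolynomial (Fin m ⊕ Fin r) k ⊗[k] MvPolynomial (Fin r) k :=
    aeval (Sum.elim (fun i => X (.inl i) ⊗ₜ 1) fun j => X (.inr j) ⊗ₜ 1 + 1 ⊗ₜ X j)
  have hTl : ∀ l : MvPolynomial (Fin m) k, T (rename Sum.inl l) = rename Sum.inl l ⊗ₜ 1 := by
    intro l
    have : T.comp (rename Sum.inl) =
        (Algebra.TensorProduct.includeLeft (R := k) (S := k)).comp (rename Sum.inl) := by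
      refine MvPolynomial.algHom_ext fun i => ?_
      simp [T]
    exact DFunLike.congr_fun this l
  have hTφ : ∀ g a, T (φ g a) = Algebra.TensorProduct.map (φ g) (AlgHom.id k _) (T a) := by
    intro g a
    have : T.comp (φ g) = (Algebra.TensorProduct.map (φ g) (AlgHom.id k _)).comp T := by
      refine MvPolynomial.algHom_ext fun i => ?_
      rcases i with i | j
      · simp [T, hx]
      · obtain ⟨l, -, hl⟩ := hy g j
        rw [AlgHom.comp_apply, AlgHom.comp_apply, hl, map_add, hTl]
        simp only [T, aeval_X, Sum.elim_inr, map_add, Algebra.TensorProduct.map_tmul, hl,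
          map_one, TensorProduct.add_tmul, AlgHom.id_apply]
        abel
    exact DFunLike.congr_fun this a
  have htr : IsTranslationStable ((fixedSubalgebra φ).map ψ) := by
    refine IsTranslationStable.map_of_coaction T (fun a => ?_) fun l b hb g => ?_
    · have : (Algebra.TensorProduct.map ψ (AlgHom.id k (MvPolynomial (Fin r) k))).comp T =
          (comulHom k (Fin r)).comp ψ := by
        refine MvPolynomial.algHom_ext fun i => ?_
        rcases i with i | j
        · simp [T, ψ]
        · simp [T, ψ, comulHom]
      exact DFunLike.congr_fun this a
    · have : ∀ z, φ g (contractRight l z) = contractRight l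
          (Algebra.TensorProduct.map (φ g) (AlgHom.id k (MvPolynomial (Fin r) k)) z) := by
        intro z
        induction z with
        | zero => simp
        | tmul a y => simp
        | add a b ha hb => simp only [map_add, ha, hb]
      rw [this, ← hTφ, hb g]
  obtain ⟨N, hN⟩ := IsPGroup.iff_card.1 hp
  rw [Nat.card_eq_fintype_card] at hN
  have hpow : ∀ j, X j ^ p ^ N ∈ (fixedSubalgebra φ).map ψ := by
    intro j
    refine ⟨∏ g, φ g (X (.inr j)), prod_mem_fixedSubalgebra _, ?_⟩
    -- All conjugates of y_j agree at x = 0, so the norm of y_j reduces to y_j to the power |Γ|.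
    have : ∀ g, ψ (φ g (X (.inr j))) = X j := by
      intro g
      obtain ⟨l, hl1, hl⟩ := hy g j
      rw [hl, map_add, hψl l hl1]
      simp [ψ]
    change ψ (∏ g, φ g (X (.inr j))) = _
    rw [map_prod]
    simp [this, hN]
  have hret' : HasRetraction ((fixedSubalgebra φ).map ψ) := by
    refine hret.map (x := (x : Set (MvPolynomial (Fin m ⊕ Fin r) k))) (fun f hf => hxB f hf)
      (fun f hf => ?_) hker (rename Sum.inr) fun y => ?_
    · obtain ⟨i, rfl⟩ := hx' f hf
      simp [ψ]
    · have : ψ.comp (rename Sum.inr) = AlgHom.id k _ := by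
        refine MvPolynomial.algHom_ext fun j => ?_
        simp [ψ]
      exact DFunLike.congr_fun this y
  obtain ⟨s, hs, hs'⟩ := (isGeneratedByHomogeneous_of_isTranslationStable p N r _ (hgr.map hψ1) hret'
    htr hpow).of_map hψ1 hgr hret hxB (fun f hf => by
      obtain ⟨i, rfl⟩ := hx' f hf
      exact isHomogeneous_X _ _) hker
  refine ⟨s, hs.trans (Nat.add_le_add_right ?_ r), hs'⟩
  exact Finset.card_image_le.trans (by simp)

/-- The retraction given by a generator of the transfer ideal. -/
theorem hasRetraction_of_dvd_sum {ι : Type*} [Fintype Γ]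
    {φ : Γ →* (MvPolynomial ι k →ₐ[k] MvPolynomial ι k)} {d : MvPolynomial ι k} (hd0 : d ≠ 0)
    (hdim : ∃ a, ∑ g, φ g a = d) (hd : ∀ a, ∃ b ∈ fixedSubalgebra φ, ∑ g, φ g a = d * b) :
    HasRetraction (fixedSubalgebra φ) := by
  choose π hπB hπ using hd
  obtain ⟨a₀, ha₀⟩ := hdim
  -- The map is a ↦ Tr(a₀a)/d; each identity is checked after multiplying by d.
  refine ⟨{ toFun := fun a => π (a₀ * a), map_add' := fun a b => ?_, map_smul' := fun c a => ?_ },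
    fun a => hπB _, ?_, fun b hb a => ?_⟩
  · refine mul_left_cancel₀ hd0 ?_
    rw [mul_add, mul_add, ← hπ, ← hπ, ← hπ, ← Finset.sum_add_distrib]
    simp
  · refine mul_left_cancel₀ hd0 ?_
    rw [RingHom.id_apply, mul_smul_comm, mul_smul_comm, ← hπ, ← hπ, Finset.smul_sum]
    simp
  · refine mul_left_cancel₀ hd0 ?_
    change d * π (a₀ * 1) = _
    rw [← hπ, mul_one, mul_one, ha₀]
  · refine mul_left_cancel₀ hd0 ?_
    change d * π (a₀ * (b * a)) = d * (b * π (a₀ * a))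
    rw [mul_left_comm a₀, ← hπ, mul_left_comm d, ← hπ, Finset.mul_sum]
    refine Finset.sum_congr rfl fun g _ => ?_
    rw [map_mul, map_mul, hb g]

end Adapted

end InvariantTheory

end


noncomputable section

namespace InvariantTheory

/-! ### Cartier operators -/

section Cartier

open MvPolynomial

variable {k ι τ : Type*} [Field k] [Fintype ι]

theorem exists_addMonoidHom_smul {K M : Type*} [Field K] [AddCommGroup M] [Module K M] {c : M}
    (hc : c ≠ 0) : ∃ l : M →+ K, (∀ (a : K) (b : M), l (a • b) = a * l b) ∧ l c ≠ 0 := by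
  by_contra! h
  exact hc ((Module.forall_dual_apply_eq_zero_iff K c).1 fun l =>
    h l.toAddMonoidHom fun a b => by simp)

/-- View k as a vector space over itself through the p^N-th power map and take a functional not
vanishing at c. It replaces the p^N-th root when k is imperfect. -/
theorem exists_frobenius_semilinear (p : ℕ) [Fact p.Prime] [CharP k p] (N : ℕ) {c : k}
    (hc : c ≠ 0) : ∃ l : k →+ k, (∀ a b : k, l (a ^ p ^ N * b) = a * l b) ∧ l c ≠ 0 := by
  have : ExpChar k p := ExpChar.prime Fact.out
  exact @exists_addMonoidHom_smul k k _ _ (Module.compHom k (iterateFrobenius k p N)) c hc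

/-- The exponent vector with entries `α i < q`. -/
def finExponent {q : ℕ} (α : ι → Fin q) : ι →₀ ℕ := Finsupp.equivFunOnFinite.symm fun i => α i

@[simp]
theorem finExponent_apply {q : ℕ} (α : ι → Fin q) (i : ι) : finExponent α i = α i := rfl

theorem finExponent_add_smul_inj {q : ℕ} {α β : ι → Fin q} {s t : ι →₀ ℕ}
    (h : finExponent α + q • s = finExponent β + q • t) : α = β ∧ s = t := by
  have h' : ∀ i, (α i : ℕ) + q * s i = β i + q * t i := fun i => by
    simpa using DFunLike.congr_fun h i
  have hα : ∀ i, (α i : ℕ) = β i := fun i => by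
    have := congrArg (· % q) (h' i)
    simpa [Nat.add_mul_mod_self_left, Nat.mod_eq_of_lt (α i).2, Nat.mod_eq_of_lt (β i).2] using this
  refine ⟨funext fun i => Fin.ext (hα i), Finsupp.ext fun i => ?_⟩
  have hq : 0 < q := (Nat.zero_le _).trans_lt (α i).2
  have := h' i
  rw [hα i] at this
  exact Nat.eq_of_mul_eq_mul_left hq (by omega)

/-- The operator picking out the part of a polynomial in `X ^ α * k[X ^ q]`, applying `l` to the
coefficients and substituting `X` for `X ^ q`. -/
def cartierOperator {q : ℕ} (α : ι → Fin q) (l : k →+ k) (b : MvPolynomial ι k) :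
    MvPolynomial ι k :=
  open Classical in
  ∑ s ∈ b.support.image (fun s => s.mapRange (· / q) (Nat.zero_div q)),
    monomial s (l (coeff (finExponent α + q • s) b))

theorem coeff_cartierOperator {q : ℕ} (α : ι → Fin q) (l : k →+ k)
    (b : MvPolynomial ι k) (s : ι →₀ ℕ) :
    coeff s (cartierOperator α l b) = l (coeff (finExponent α + q • s) b) := by
  classical
  simp only [cartierOperator, coeff_sum, coeff_monomial, Finset.sum_ite_eq']
  split_ifs with h
  · rfl
  · have : coeff (finExponent α + q • s) b = 0 := by
      by_contra hne
      refine h (Finset.mem_image.2 ⟨_, mem_support_iff.2 hne, Finsupp.ext fun i => ?_⟩)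
      have hq : 0 < q := (Nat.zero_le _).trans_lt (α i).2
      simp [Nat.add_mul_div_left _ _ hq, Nat.div_eq_of_lt (α i).2]
    rw [this, map_zero]

theorem cartierOperator_add {q : ℕ} (α : ι → Fin q) (l : k →+ k) (a b : MvPolynomial ι k) :
    cartierOperator α l (a + b) = cartierOperator α l a + cartierOperator α l b := by
  ext s
  simp [coeff_cartierOperator]

theorem cartierOperator_sum {q : ℕ} (α : ι → Fin q) (l : k →+ k) {σ : Type*} (S : Finset σ)
    (a : σ → MvPolynomial ι k) :
    cartierOperator α l (∑ j ∈ S, a j) = ∑ j ∈ S, cartierOperator α l (a j) := by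
  ext s
  simp [coeff_cartierOperator, coeff_sum]

/-- Taking p^N-th powers is additive, so a may be a monomial; multiplying by its power then shifts
exponents by multiples of p^N and leaves residues alone. -/
theorem cartierOperator_pow_mul (p : ℕ) [Fact p.Prime] [CharP k p] (N : ℕ)
    (α : ι → Fin (p ^ N)) {l : k →+ k} (hl : ∀ a b : k, l (a ^ p ^ N * b) = a * l b)
    (a b : MvPolynomial ι k) :
    cartierOperator α l (a ^ p ^ N * b) = a * cartierOperator α l b := by
  classical
  have : ExpChar (MvPolynomial ι k) p := ExpChar.prime Fact.out
  induction a using MvPolynomial.induction_on' with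
  | add a a' ha ha' => rw [add_pow_expChar_pow, add_mul, cartierOperator_add, ha, ha', add_mul]
  | monomial t c =>
    ext s
    rw [coeff_cartierOperator, monomial_pow, coeff_monomial_mul', coeff_monomial_mul']
    have hle : p ^ N • t ≤ finExponent α + p ^ N • s ↔ t ≤ s := by
      simp only [Finsupp.le_def, Finsupp.add_apply, Finsupp.smul_apply, smul_eq_mul,
        finExponent_apply]
      refine forall_congr' fun i => ⟨fun h => ?_, fun h => ?_⟩
      · by_contra hlt
        have h1 : p ^ N * (s i + 1) ≤ p ^ N * t i := Nat.mul_le_mul_left _ (by omega)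
        have := (α i).2
        rw [mul_add] at h1
        omega
      · exact (Nat.mul_le_mul_left _ h).trans (Nat.le_add_left _ _)
    by_cases hts : t ≤ s
    · rw [if_pos (hle.2 hts), if_pos hts, hl, coeff_cartierOperator]
      congr 3
      ext i
      have := hts i
      simp only [Finsupp.tsub_apply, Finsupp.add_apply, Finsupp.smul_apply, smul_eq_mul,
        Nat.mul_sub]
      have := Nat.mul_le_mul_left (p ^ N) this
      omega
    · rw [if_neg (mt hle.1 hts), if_neg hts, map_zero]

theorem cartierOperator_monomial {q : ℕ} (α β : ι → Fin q) (l : k →+ k) (c : k) :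
    cartierOperator α l (monomial (finExponent β) c) = if α = β then C (l c) else 0 := by
  classical
  ext s
  rw [coeff_cartierOperator, coeff_monomial]
  have h1 : finExponent β = finExponent α + q • s ↔ α = β ∧ s = 0 := by
    constructor
    · intro h
      have : finExponent α + q • s = finExponent β + q • (0 : ι →₀ ℕ) := by simp [h]
      exact finExponent_add_smul_inj this
    · rintro ⟨rfl, rfl⟩
      simp
  by_cases hαβ : α = β
  · by_cases hs : s = 0
    · rw [if_pos (h1.2 ⟨hαβ, hs⟩), if_pos hαβ, hs, coeff_zero_C]
    · rw [if_neg (fun h => hs (h1.1 h).2), if_pos hαβ, map_zero, coeff_C, if_neg (Ne.symm hs)]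
  · rw [if_neg (fun h => hαβ (h1.1 h).1), if_neg hαβ, map_zero, coeff_zero]

end Cartier

/-! ### Freeness over k[f] by counting dimensions modulo Frobenius powers -/

section FrobeniusBasis

open MvPolynomial

variable {k ι τ : Type*} [Field k] [Fintype ι] [Fintype τ]

/-- The products `X ^ α * e i ^ q`, `α < q`, are independent modulo the `q`-th powers. -/
theorem linearIndependent_monomial_mul_pow (p : ℕ) [Fact p.Prime] [CharP k p] (N : ℕ)
    (f : ι → MvPolynomial ι k) (e : τ → MvPolynomial ι k)
    (he : LinearIndependent k fun i => Ideal.Quotient.mk (Ideal.span (Set.range f)) (e i)) :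
    LinearIndependent k fun x : (ι → Fin (p ^ N)) × τ =>
      Ideal.Quotient.mk (Ideal.span (Set.range fun j => f j ^ p ^ N))
        (monomial (finExponent x.1) 1 * e x.2 ^ p ^ N) := by
  classical
  rw [Fintype.linearIndependent_iff]
  rintro c hc ⟨α, i₀⟩
  by_contra hne
  obtain ⟨l, hl, hlc⟩ := exists_frobenius_semilinear p N hne
  rw [← Ideal.Quotient.mkₐ_eq_mk k] at hc
  simp only [← map_smul, ← map_sum] at hc
  rw [Ideal.Quotient.mkₐ_eq_mk, Ideal.Quotient.eq_zero_iff_mem, Ideal.mem_span_range_iff_exists_fun]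
    at hc
  obtain ⟨a, ha⟩ := hc
  -- The operator isolates the exponent α, takes c·e_i^q to l(c)·e_i, and takes (f_j^q) into (f).
  -- This leaves a relation among the e_i modulo (f) with a nonzero coefficient.
  have h1 := congrArg (cartierOperator α l) ha
  rw [cartierOperator_sum, cartierOperator_sum, Fintype.sum_prod_type] at h1
  have h2 : ∀ (β : ι → Fin (p ^ N)) i, cartierOperator α l
      (c (β, i) • (monomial (finExponent β) 1 * e i ^ p ^ N)) =
      if α = β then C (l (c (β, i))) * e i else 0 := by
    intro β i
    rw [← smul_mul_assoc, smul_monomial, mul_comm, cartierOperator_pow_mul p N α hl,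
      cartierOperator_monomial, smul_eq_mul, mul_one, mul_comm]
    split_ifs <;> simp
  simp only [h2] at h1
  rw [Finset.sum_eq_single α (fun β _ hβ => Finset.sum_eq_zero fun i _ => if_neg hβ.symm)
    (fun h => absurd (Finset.mem_univ _) h)] at h1
  simp only [if_true] at h1
  have h3 : ∑ i, C (l (c (α, i))) * e i ∈ Ideal.span (Set.range f) := by
    rw [← h1]
    refine sum_mem fun j _ => ?_
    rw [mul_comm, cartierOperator_pow_mul p N α hl]
    exact Ideal.mul_mem_right _ _ (Ideal.subset_span ⟨j, rfl⟩)
  rw [Fintype.linearIndependent_iff] at he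
  refine hlc (he (fun i => l (c (α, i))) ?_ i₀)
  rw [← Ideal.Quotient.eq_zero_iff_mem, ← Ideal.Quotient.mkₐ_eq_mk k, map_sum] at h3
  rw [← h3]
  refine Finset.sum_congr rfl fun i _ => ?_
  rw [← smul_eq_C_mul, map_smul]
  rfl

theorem mem_span_prod_pow_of_mem_adjoin {q : ℕ} (f : ι → MvPolynomial ι k)
    {b : MvPolynomial ι k} (hb : b ∈ Algebra.adjoin k (Set.range f)) (e : MvPolynomial ι k) :
    Ideal.Quotient.mk (Ideal.span (Set.range fun j => f j ^ q)) (b * e) ∈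
      Submodule.span k (Set.range fun β : ι → Fin q =>
        Ideal.Quotient.mk (Ideal.span (Set.range fun j => f j ^ q)) ((∏ j, f j ^ (β j : ℕ)) * e)) := by
  classical
  rw [Algebra.adjoin_range_eq_range_aeval] at hb
  obtain ⟨P, rfl⟩ := hb
  induction P using MvPolynomial.induction_on' with
  | add P Q hP hQ =>
    rw [map_add, add_mul, map_add]
    exact add_mem hP hQ
  | monomial s c =>
    have h1 : (aeval f : MvPolynomial ι k →ₐ[k] _).toRingHom (monomial s c) * e =
        c • ((∏ j, f j ^ s j) * e) := by
      change aeval f (monomial s c) * e = _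
      rw [aeval_monomial, Finsupp.prod_fintype _ _ (by simp), Algebra.smul_def, mul_assoc]
    rw [h1, ← Ideal.Quotient.mkₐ_eq_mk k, map_smul]
    refine Submodule.smul_mem _ _ ?_
    by_cases h : ∀ j, s j < q
    · exact Submodule.subset_span ⟨fun j => ⟨s j, h j⟩, rfl⟩
    · push Not at h
      obtain ⟨j, hj⟩ := h
      have : (∏ j, f j ^ s j) * e ∈ Ideal.span (Set.range fun j => f j ^ q) := by
        refine Ideal.mul_mem_right _ _ ?_
        refine Ideal.mem_of_dvd _ ?_ (Ideal.subset_span ⟨j, rfl⟩)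
        exact (pow_dvd_pow _ hj).trans (Finset.dvd_prod_of_mem _ (Finset.mem_univ j))
      rw [Ideal.Quotient.mkₐ_eq_mk, Ideal.Quotient.eq_zero_iff_mem.2 this]
      exact zero_mem _

/-- The products `f ^ β * e i`, `β < q`, span modulo the `q`-th powers. -/
theorem span_prod_pow_mul_eq_top (q : ℕ) (f : ι → MvPolynomial ι k) (e : τ → MvPolynomial ι k)
    (hspan : ∀ a, ∃ b : τ → MvPolynomial ι k, (∀ i, b i ∈ Algebra.adjoin k (Set.range f)) ∧
      a = ∑ i, b i * e i) :
    Submodule.span k (Set.range fun x : (ι → Fin q) × τ =>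
      Ideal.Quotient.mk (Ideal.span (Set.range fun j => f j ^ q))
        ((∏ j, f j ^ (x.1 j : ℕ)) * e x.2)) = ⊤ := by
  rw [eq_top_iff]
  rintro y -
  obtain ⟨a, rfl⟩ := Ideal.Quotient.mk_surjective y
  obtain ⟨b, hb, rfl⟩ := hspan a
  rw [map_sum]
  refine sum_mem fun i _ => ?_
  refine Submodule.span_mono ?_ (mem_span_prod_pow_of_mem_adjoin f (hb i) (e i))
  rintro _ ⟨β, rfl⟩
  exact ⟨(β, i), rfl⟩

/-- The independent family X^α e_i^q and the spanning family f^β e_i share one index set, which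
squeezes the dimension from both sides. -/
theorem finrank_quotient_pow_eq [DecidableEq ι] (p : ℕ) [Fact p.Prime] [CharP k p] (N : ℕ)
    (f : ι → MvPolynomial ι k) (e : τ → MvPolynomial ι k)
    (he : LinearIndependent k fun i => Ideal.Quotient.mk (Ideal.span (Set.range f)) (e i))
    (hspan : ∀ a, ∃ b : τ → MvPolynomial ι k, (∀ i, b i ∈ Algebra.adjoin k (Set.range f)) ∧
      a = ∑ i, b i * e i) :
    Module.Finite k (MvPolynomial ι k ⧸ Ideal.span (Set.range fun j => f j ^ p ^ N)) ∧
    Fintype.card ((ι → Fin (p ^ N)) × τ) =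
      Module.finrank k (MvPolynomial ι k ⧸ Ideal.span (Set.range fun j => f j ^ p ^ N)) := by
  have h1 := linearIndependent_monomial_mul_pow p N f e he
  have h2 := span_prod_pow_mul_eq_top (p ^ N) f e hspan
  have hfin : Module.Finite k (MvPolynomial ι k ⧸ Ideal.span (Set.range fun j => f j ^ p ^ N)) :=
    ⟨⟨(Set.finite_range _).toFinset, by rw [Set.Finite.coe_toFinset]; exact h2⟩⟩
  refine ⟨hfin, le_antisymm h1.fintype_card_le_finrank ?_⟩
  rw [← finrank_top, ← h2]
  exact finrank_range_le_card _

theorem linearIndependent_prod_pow_mul (p : ℕ) [Fact p.Prime] [CharP k p] (N : ℕ)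
    (f : ι → MvPolynomial ι k) (e : τ → MvPolynomial ι k)
    (he : LinearIndependent k fun i => Ideal.Quotient.mk (Ideal.span (Set.range f)) (e i))
    (hspan : ∀ a, ∃ b : τ → MvPolynomial ι k, (∀ i, b i ∈ Algebra.adjoin k (Set.range f)) ∧
      a = ∑ i, b i * e i) :
    LinearIndependent k fun x : (ι → Fin (p ^ N)) × τ =>
      Ideal.Quotient.mk (Ideal.span (Set.range fun j => f j ^ p ^ N))
        ((∏ j, f j ^ (x.1 j : ℕ)) * e x.2) := by
  classical
  exact linearIndependent_of_top_le_span_of_card_eq_finrank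
      (span_prod_pow_mul_eq_top (p ^ N) f e hspan).ge (finrank_quotient_pow_eq p N f e he hspan).2

theorem coeff_eq_zero_of_le_apply {q : ℕ} {P : MvPolynomial ι k} (hP : P.totalDegree < q)
    {s : ι →₀ ℕ} {j : ι} (hj : q ≤ s j) : coeff s P = 0 := by
  by_contra hne
  have h1 := le_totalDegree (mem_support_iff.2 hne)
  have h3 : s j ≤ s.degree := Finsupp.le_degree j s
  rw [Finsupp.degree_eq_sum] at h3
  rw [Finsupp.sum_fintype _ _ (by simp)] at h1
  omega

theorem eq_sum_monomial_finExponent [DecidableEq ι] {q : ℕ} {P : MvPolynomial ι k}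
    (hP : P.totalDegree < q) :
    P = ∑ β : ι → Fin q, monomial (finExponent β) (coeff (finExponent β) P) := by
  classical
  ext s
  rw [coeff_sum]
  by_cases hs : ∀ j, s j < q
  · have hβ : finExponent (fun j => (⟨s j, hs j⟩ : Fin q)) = s := Finsupp.ext fun j => rfl
    rw [Finset.sum_eq_single fun j => (⟨s j, hs j⟩ : Fin q)]
    · rw [hβ, coeff_monomial, if_pos rfl]
    · intro β _ hne
      rw [coeff_monomial, if_neg]
      intro h
      refine hne (funext fun j => Fin.ext ?_)
      simpa using DFunLike.congr_fun h j
    · exact fun h => absurd (Finset.mem_univ _) h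
  · push Not at hs
    obtain ⟨j, hj⟩ := hs
    rw [coeff_eq_zero_of_le_apply hP hj, eq_comm]
    refine Finset.sum_eq_zero fun β _ => ?_
    rw [coeff_monomial, if_neg]
    intro h
    have h1 : (β j : ℕ) = s j := DFunLike.congr_fun h j
    have := (β j).2
    omega

/-- A lift of a basis of the fibre ring is linearly independent over `k[f]`. -/
theorem eq_zero_of_sum_aeval_mul_eq_zero (p : ℕ) [Fact p.Prime] [CharP k p]
    (f : ι → MvPolynomial ι k) (e : τ → MvPolynomial ι k)
    (he : LinearIndependent k fun i => Ideal.Quotient.mk (Ideal.span (Set.range f)) (e i))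
    (hspan : ∀ a, ∃ b : τ → MvPolynomial ι k, (∀ i, b i ∈ Algebra.adjoin k (Set.range f)) ∧
      a = ∑ i, b i * e i)
    (P : τ → MvPolynomial ι k) (hP : ∑ i, aeval f (P i) * e i = 0) (i : τ) : P i = 0 := by
  classical
  -- With p^N beyond all degrees, the relation involves only products f^β e_i with β < p^N, and
  -- these are independent modulo the p^N-th powers.
  obtain ⟨N, hN⟩ : ∃ N, ∀ i, (P i).totalDegree < p ^ N := by
    obtain ⟨N, hN⟩ := pow_unbounded_of_one_lt (Finset.univ.sup fun i => (P i).totalDegree)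
      (Fact.out : p.Prime).one_lt
    exact ⟨N, fun i => (Finset.le_sup (f := fun i => (P i).totalDegree)
      (Finset.mem_univ i)).trans_lt hN⟩
  have hli := linearIndependent_prod_pow_mul p N f e he hspan
  rw [Fintype.linearIndependent_iff] at hli
  have hexp : ∀ i, aeval f (P i) = ∑ β : ι → Fin (p ^ N),
      coeff (finExponent β) (P i) • ∏ j, f j ^ (β j : ℕ) := by
    intro i
    conv_lhs => rw [eq_sum_monomial_finExponent (hN i), map_sum]
    refine Finset.sum_congr rfl fun β _ => ?_
    rw [aeval_monomial, Finsupp.prod_fintype _ _ (by simp), Algebra.smul_def]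
    rfl
  have h0 := hli (fun x => coeff (finExponent x.1) (P x.2)) (by
    have := congrArg (Ideal.Quotient.mkₐ k (Ideal.span (Set.range fun j => f j ^ p ^ N))) hP
    rw [map_zero, map_sum] at this
    rw [← this, Fintype.sum_prod_type_right]
    refine Finset.sum_congr rfl fun i _ => ?_
    rw [hexp, Finset.sum_mul, map_sum]
    refine Finset.sum_congr rfl fun β _ => ?_
    rw [smul_mul_assoc, map_smul]
    rfl)
  ext s
  rw [coeff_zero]
  by_cases hs : ∀ j, s j < p ^ N
  · have hβ : finExponent (fun j => (⟨s j, hs j⟩ : Fin (p ^ N))) = s := Finsupp.ext fun j => rfl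
    have := h0 (fun j => ⟨s j, hs j⟩, i)
    rwa [hβ] at this
  · push Not at hs
    obtain ⟨j, hj⟩ := hs
    exact coeff_eq_zero_of_le_apply (hN i) hj

end FrobeniusBasis

end InvariantTheory

end


noncomputable section

namespace InvariantTheory

/-! ### Homogeneity in integer degrees, for coefficients whose expected degree may be negative -/

section IntegerDegree

open MvPolynomial

variable {k ι : Type*} [Field k]

/-- Homogeneity with respect to a possibly negative degree; only `0` has negative degree. -/
def IsHomogeneousInt (b : MvPolynomial ι k) (n : ℤ) : Prop :=
  ∀ s, coeff s b ≠ 0 → (s.degree : ℤ) = n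

theorem isHomogeneousInt_iff {b : MvPolynomial ι k} {n : ℕ} :
    IsHomogeneousInt b n ↔ b.IsHomogeneous n := by
  simp only [IsHomogeneousInt, IsHomogeneous, IsWeightedHomogeneous]
  refine forall_congr' fun s => forall_congr' fun _ => ?_
  rw [Nat.cast_inj, Finsupp.degree_eq_weight_one]
  rfl

theorem isHomogeneousInt_zero (n : ℤ) : IsHomogeneousInt (0 : MvPolynomial ι k) n :=
  fun s hs => absurd (coeff_zero s) hs

theorem IsHomogeneousInt.add {a b : MvPolynomial ι k} {n : ℤ} (ha : IsHomogeneousInt a n)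
    (hb : IsHomogeneousInt b n) : IsHomogeneousInt (a + b) n := by
  intro s hs
  by_cases h : coeff s a = 0
  · exact hb s (by rw [coeff_add, h, zero_add] at hs; exact hs)
  · exact ha s h

theorem IsHomogeneousInt.sum {σ : Type*} (S : Finset σ) {a : σ → MvPolynomial ι k} {n : ℤ}
    (ha : ∀ j ∈ S, IsHomogeneousInt (a j) n) : IsHomogeneousInt (∑ j ∈ S, a j) n := by
  classical
  induction S using Finset.induction_on with
  | empty => simpa using isHomogeneousInt_zero n
  | insert j S hj ih =>
    rw [Finset.sum_insert hj]
    exact (ha j (Finset.mem_insert_self _ _)).add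
      (ih fun i hi => ha i (Finset.mem_insert_of_mem hi))

theorem IsHomogeneousInt.mul {a b : MvPolynomial ι k} {n m : ℤ} (ha : IsHomogeneousInt a n)
    (hb : IsHomogeneousInt b m) : IsHomogeneousInt (a * b) (n + m) := by
  classical
  intro s hs
  rw [coeff_mul] at hs
  obtain ⟨⟨x, y⟩, hxy, hne⟩ := Finset.exists_ne_zero_of_sum_ne_zero hs
  rw [Finset.HasAntidiagonal.mem_antidiagonal] at hxy
  rw [← ha x (left_ne_zero_of_mul hne), ← hb y (right_ne_zero_of_mul hne), ← hxy, map_add]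
  push_cast
  rfl

theorem IsHomogeneousInt.prod {σ : Type*} (S : Finset σ) {a : σ → MvPolynomial ι k} {n : σ → ℤ}
    (ha : ∀ j ∈ S, IsHomogeneousInt (a j) (n j)) :
    IsHomogeneousInt (∏ j ∈ S, a j) (∑ j ∈ S, n j) := by
  classical
  induction S using Finset.induction_on with
  | empty =>
    simpa using isHomogeneousInt_iff.2 (isHomogeneous_one ι k)
  | insert j S hj ih =>
    rw [Finset.prod_insert hj, Finset.sum_insert hj]
    exact (ha j (Finset.mem_insert_self _ _)).mul
      (ih fun i hi => ha i (Finset.mem_insert_of_mem hi))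

theorem IsHomogeneousInt.neg {a : MvPolynomial ι k} {n : ℤ} (ha : IsHomogeneousInt a n) :
    IsHomogeneousInt (-a) n := by
  intro s hs
  exact ha s (by simpa using hs)

theorem IsHomogeneousInt.eq_C {a : MvPolynomial ι k} (ha : IsHomogeneousInt a 0) :
    a = C (coeff 0 a) := by
  classical
  ext s
  rw [coeff_C]
  split_ifs with h
  · rw [h]
  · by_contra hne
    have := ha s hne
    rw [Nat.cast_eq_zero, Finsupp.degree_eq_zero_iff] at this
    exact h this.symm

end IntegerDegree

/-! ### Degree sums of homogeneous bases -/

section FibreBasis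

open MvPolynomial

variable {k ι τ : Type*} [Field k] [Fintype ι]

theorem homogeneousComponent_mem_span_range {f : ι → MvPolynomial ι k} {d : ι → ℕ}
    (hf : ∀ j, (f j).IsHomogeneous (d j)) {a : MvPolynomial ι k}
    (ha : a ∈ Ideal.span (Set.range f)) (n : ℕ) :
    homogeneousComponent n a ∈ Ideal.span (Set.range f) := by
  rw [Ideal.mem_span_range_iff_exists_fun] at ha
  obtain ⟨c, rfl⟩ := ha
  rw [map_sum]
  refine sum_mem fun j _ => ?_
  rw [mul_comm, homogeneousComponent_mul_of_isHomogeneous (hf j)]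
  split_ifs
  · exact Ideal.mul_mem_right _ _ (Ideal.subset_span ⟨j, rfl⟩)
  · exact zero_mem _

omit [Fintype ι] in
/-- Two homogeneous bases of a graded quotient have the same sum of degrees. -/
theorem sum_degree_eq_of_basis {σ : Type*} [Fintype σ] {I : Ideal (MvPolynomial ι k)}
    (hI : ∀ a ∈ I, ∀ n, homogeneousComponent n a ∈ I) {u v : σ → MvPolynomial ι k}
    {du dv : σ → ℕ} (hu : ∀ x, (u x).IsHomogeneous (du x)) (hv : ∀ x, (v x).IsHomogeneous (dv x))
    (hui : LinearIndependent k fun x => Ideal.Quotient.mk I (u x))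
    (hvi : LinearIndependent k fun x => Ideal.Quotient.mk I (v x))
    (hvs : Submodule.span k (Set.range fun x => Ideal.Quotient.mk I (v x)) = ⊤) :
    ∑ x, du x = ∑ x, dv x := by
  classical
  have h1 : ∀ x, ∃ c : σ → k, ∑ y, c y • Ideal.Quotient.mk I (v y) = Ideal.Quotient.mk I (u x) := by
    intro x
    rw [← Submodule.mem_span_range_iff_exists_fun, hvs]
    exact Submodule.mem_top
  choose M hM using h1
  have hMI : ∀ x, u x - ∑ y, M x y • v y ∈ I := by
    intro x
    rw [← Ideal.Quotient.eq_zero_iff_mem, ← Ideal.Quotient.mkₐ_eq_mk k, map_sub, map_sum,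
      sub_eq_zero, Ideal.Quotient.mkₐ_eq_mk, ← hM x]
    rfl
  have hMdeg : ∀ x y, M x y ≠ 0 → du x = dv y := by
    intro x
    have h2 := hI _ (hMI x) (du x)
    have h3 : homogeneousComponent (du x) (u x - ∑ y, M x y • v y) =
        u x - ∑ y, (if du x = dv y then M x y else 0) • v y := by
      rw [map_sub, map_sum, homogeneousComponent_eq_self (hu x)]
      congr 1
      refine Finset.sum_congr rfl fun y _ => ?_
      rw [map_smul, homogeneousComponent_of_mem (hv y)]
      split_ifs <;> simp
    rw [h3] at h2
    have h4 := I.sub_mem h2 (hMI x)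
    rw [sub_sub_sub_cancel_left, ← Finset.sum_sub_distrib, ← Ideal.Quotient.eq_zero_iff_mem,
      ← Ideal.Quotient.mkₐ_eq_mk k, map_sum] at h4
    simp only [← sub_smul, map_smul] at h4
    rw [Fintype.linearIndependent_iff] at hvi
    intro y hy
    have h5 := hvi _ h4 y
    by_contra hne
    rw [if_neg hne, sub_zero] at h5
    exact hy h5
  have hdet : Matrix.det (Matrix.of M) ≠ 0 := by
    intro h0
    obtain ⟨c, hc0, hc⟩ := Matrix.exists_vecMul_eq_zero_iff.2 h0
    refine hc0 (funext fun x => ?_)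
    rw [Fintype.linearIndependent_iff] at hui
    refine hui c ?_ x
    simp only [← hM, Finset.smul_sum, smul_smul]
    rw [Finset.sum_comm]
    refine Finset.sum_eq_zero fun y _ => ?_
    rw [← Finset.sum_smul]
    have := congrFun hc y
    simp only [Matrix.vecMul, dotProduct, Matrix.of_apply, Pi.zero_apply] at this
    rw [this, zero_smul]
  rw [Matrix.det_apply] at hdet
  -- The transition matrix links only elements of equal degree. A nonzero term of its determinant is
  -- thus a degree-preserving bijection between the two bases.
  obtain ⟨π, -, hπ⟩ := Finset.exists_ne_zero_of_sum_ne_zero hdet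
  have hπ' : ∏ i, M (π i) i ≠ 0 := by
    intro h
    refine hπ ?_
    simp only [Matrix.of_apply, h, smul_zero]
  rw [← Equiv.sum_comp π]
  exact Finset.sum_congr rfl fun x _ => hMdeg _ _ (Finset.prod_ne_zero_iff.1 hπ' x (Finset.mem_univ x))

/-- Reversing every coordinate pairs the value t with q - 1 - t. -/
theorem two_mul_sum_fin_apply [DecidableEq ι] (q : ℕ) (j : ι) :
    2 * ∑ α : ι → Fin q, ((α j : ℕ) : ℤ) = (q - 1) * q ^ Fintype.card ι := by
  have h1 : ∑ α : ι → Fin q, (((α j).rev : ℕ) : ℤ) = ∑ α : ι → Fin q, ((α j : ℕ) : ℤ) :=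
    Equiv.sum_comp (Equiv.piCongrRight fun _ : ι => Fin.revPerm (n := q))
      fun α => ((α j : ℕ) : ℤ)
  have h2 : ∑ α : ι → Fin q, (((α j : ℕ) : ℤ) + (((α j).rev : ℕ) : ℤ)) =
      ∑ α : ι → Fin q, ((q : ℤ) - 1) := by
    refine Finset.sum_congr rfl fun α _ => ?_
    rw [Fin.val_rev]
    have := (α j).2
    omega
  rw [Finset.sum_add_distrib, h1] at h2
  rw [two_mul, h2]
  simp
  ring

/-- The degrees of a homogeneous basis of the fibre ring are distributed symmetrically on
average. -/
theorem two_mul_sum_degree_eq [Fintype τ] (p : ℕ) [Fact p.Prime] [CharP k p]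
    (f : ι → MvPolynomial ι k) (e : τ → MvPolynomial ι k) {d : ι → ℕ} {δ : τ → ℕ}
    (hf : ∀ j, (f j).IsHomogeneous (d j)) (hδ : ∀ i, (e i).IsHomogeneous (δ i))
    (he : LinearIndependent k fun i => Ideal.Quotient.mk (Ideal.span (Set.range f)) (e i))
    (hspan : ∀ a, ∃ b : τ → MvPolynomial ι k, (∀ i, b i ∈ Algebra.adjoin k (Set.range f)) ∧
      a = ∑ i, b i * e i) :
    2 * ∑ i, (δ i : ℤ) = Fintype.card τ * ∑ j, ((d j : ℤ) - 1) := by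
  classical
  -- The bases X^α e_i^p and f^β e_i modulo (f^p) have equal degree sums; exponents below p average
  -- (p - 1)/2, and the factor (p - 1)p^n cancels at the end.
  have key := sum_degree_eq_of_basis
    (I := Ideal.span (Set.range fun j => f j ^ p ^ 1))
    (fun a ha n => homogeneousComponent_mem_span_range (fun j => (hf j).pow (p ^ 1)) ha n)
    (u := fun x : (ι → Fin (p ^ 1)) × τ => monomial (finExponent x.1) 1 * e x.2 ^ p ^ 1)
    (v := fun x => (∏ j, f j ^ (x.1 j : ℕ)) * e x.2)
    (du := fun x => (∑ j, (x.1 j : ℕ)) + δ x.2 * p ^ 1)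
    (dv := fun x => (∑ j, d j * (x.1 j : ℕ)) + δ x.2)
    (fun x => (isHomogeneous_monomial _ (by rw [Finsupp.degree_eq_sum]; rfl)).mul ((hδ _).pow _))
    (fun x => (IsHomogeneous.prod _ _ _ fun j _ => (hf j).pow _).mul (hδ _))
    (linearIndependent_monomial_mul_pow p 1 f e he)
    (linearIndependent_prod_pow_mul p 1 f e he hspan)
    (span_prod_pow_mul_eq_top (p ^ 1) f e hspan)
  rw [pow_one] at key
  have hp := (Fact.out : p.Prime).one_lt
  have hc := fun j : ι => two_mul_sum_fin_apply (ι := ι) p j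
  have key := congrArg (Nat.cast : ℕ → ℤ) key
  push_cast at key
  simp only [Fintype.sum_prod_type, Finset.sum_add_distrib, Finset.sum_const, Finset.card_univ,
    nsmul_eq_mul, ← Finset.mul_sum, ← Finset.sum_mul] at key
  have c1 : ∑ α : ι → Fin p, ∑ j, ((α j : ℕ) : ℤ) = ∑ j, ∑ α : ι → Fin p, ((α j : ℕ) : ℤ) :=
    Finset.sum_comm
  have c2 : ∑ α : ι → Fin p, ∑ j, (d j : ℤ) * ((α j : ℕ) : ℤ) =
      ∑ j, (d j : ℤ) * ∑ α : ι → Fin p, ((α j : ℕ) : ℤ) := by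
    rw [Finset.sum_comm]
    simp only [Finset.mul_sum]
  rw [c1, c2] at key
  have e1 : 2 * ∑ j : ι, ∑ α : ι → Fin p, ((α j : ℕ) : ℤ) =
      Fintype.card ι * ((p - 1) * p ^ Fintype.card ι) := by
    rw [Finset.mul_sum, Finset.sum_congr rfl fun j _ => hc j]
    simp
  have e2 : 2 * ∑ j : ι, (d j : ℤ) * ∑ α : ι → Fin p, ((α j : ℕ) : ℤ) =
      (∑ j, (d j : ℤ)) * ((p - 1) * p ^ Fintype.card ι) := by
    rw [Finset.mul_sum, Finset.sum_mul]
    exact Finset.sum_congr rfl fun j _ => by rw [mul_left_comm, hc j]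
  have e3 : (Fintype.card (ι → Fin p) : ℤ) = p ^ Fintype.card ι := by simp
  rw [e3] at key
  set E := ∑ i, (δ i : ℤ)
  set Q : ℤ := (p : ℤ) ^ Fintype.card ι
  have hQ : Q ≠ 0 := pow_ne_zero _ (by exact_mod_cast (by omega : p ≠ 0))
  have hp1 : (p : ℤ) - 1 ≠ 0 := by
    have : (1 : ℤ) < p := by exact_mod_cast hp
    omega
  have hsub : ∑ j, ((d j : ℤ) - 1) = ∑ j, (d j : ℤ) - Fintype.card ι := by simp
  rw [hsub]
  refine mul_left_cancel₀ (mul_ne_zero hp1 hQ) ?_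
  linear_combination 2 * key + (Fintype.card τ : ℤ) * e2 - (Fintype.card τ : ℤ) * e1

end FibreBasis

end InvariantTheory

end


noncomputable section

namespace InvariantTheory

/-! ### Homogeneous bases of the fibre ring and graded Nakayama -/

section ExistsFibreBasis

open MvPolynomial

variable {k ι τ : Type*} [Field k] [Fintype ι]

omit [Fintype ι] in
theorem coeff_zero_eq_zero_of_isHomogeneous {a : MvPolynomial ι k} {d : ℕ}
    (ha : a.IsHomogeneous d) (hd : 0 < d) : coeff 0 a = 0 :=
  ha.coeff_eq_zero (by simpa using hd.ne)

/-- Modulo (f), elements of k[f] become their constant terms, so integral equations over k[f] become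
equations over k; the quotient is a finitely generated algebra integral over k. -/
theorem finite_quotient_of_isIntegral {f : ι → MvPolynomial ι k} {d : ι → ℕ}
    (hf : ∀ j, (f j).IsHomogeneous (d j)) (hd : ∀ j, 0 < d j)
    (hint : Algebra.IsIntegral (Algebra.adjoin k (Set.range f)) (MvPolynomial ι k)) :
    Module.Finite k (MvPolynomial ι k ⧸ Ideal.span (Set.range f)) := by
  set I := Ideal.span (Set.range f)
  have hB : ∀ b ∈ Algebra.adjoin k (Set.range f),
      Ideal.Quotient.mk I b = algebraMap k (MvPolynomial ι k ⧸ I) (coeff 0 b) := by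
    intro b hb
    rw [← constantCoeff_eq]
    induction hb using Algebra.adjoin_induction with
    | mem x hx =>
      obtain ⟨j, rfl⟩ := hx
      rw [constantCoeff_eq, coeff_zero_eq_zero_of_isHomogeneous (hf j) (hd j), map_zero]
      exact Ideal.Quotient.eq_zero_iff_mem.2 (Ideal.subset_span ⟨j, rfl⟩)
    | algebraMap r =>
      rw [MvPolynomial.algebraMap_eq, constantCoeff_C]
      rfl
    | add x y _ _ hx hy => rw [map_add, map_add, map_add, hx, hy]
    | mul x y _ _ hx hy => rw [map_mul, map_mul, map_mul, hx, hy]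
  have hi : Algebra.IsIntegral k (MvPolynomial ι k ⧸ I) := by
    refine ⟨fun y => ?_⟩
    obtain ⟨a, rfl⟩ := Ideal.Quotient.mk_surjective y
    obtain ⟨h, hm, h0⟩ := hint.isIntegral a
    refine ⟨h.map ((constantCoeff : MvPolynomial ι k →+* k).comp
      (Algebra.adjoin k (Set.range f)).val.toRingHom), hm.map _, ?_⟩
    rw [Polynomial.eval₂_map]
    have h1 := congrArg (Ideal.Quotient.mk I) h0
    rw [Polynomial.hom_eval₂, map_zero] at h1
    have hcomp : (algebraMap k (MvPolynomial ι k ⧸ I)).comp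
        ((constantCoeff : MvPolynomial ι k →+* k).comp
          (Algebra.adjoin k (Set.range f)).val.toRingHom) = (Ideal.Quotient.mk I).comp
        (algebraMap (Algebra.adjoin k (Set.range f)) (MvPolynomial ι k)) :=
      RingHom.ext fun b => (hB b b.2).symm
    rw [hcomp]
    exact h1
  exact Algebra.IsIntegral.finite

omit [Fintype ι] in
/-- The fibre ring has a basis of monomials. -/
theorem exists_monomial_fibre_basis {f : ι → MvPolynomial ι k}
    (hfin : Module.Finite k (MvPolynomial ι k ⧸ Ideal.span (Set.range f))) :
    ∃ (n : ℕ) (s : Fin n → ι →₀ ℕ),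
      LinearIndependent k (fun i =>
        Ideal.Quotient.mk (Ideal.span (Set.range f)) (monomial (s i) 1)) ∧
      Submodule.span k (Set.range fun i =>
        Ideal.Quotient.mk (Ideal.span (Set.range f)) (monomial (s i) (1 : k))) = ⊤ := by
  obtain ⟨κ, a, -, hspan, hli⟩ := exists_linearIndependent' k fun s : ι →₀ ℕ =>
    Ideal.Quotient.mk (Ideal.span (Set.range f)) (monomial s (1 : k))
  have hκ : Finite κ := hli.finite
  have := Fintype.ofFinite κ
  let e := Fintype.equivFin κ
  refine ⟨Fintype.card κ, fun i => a (e.symm i), hli.comp _ e.symm.injective, ?_⟩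
  have h1 : (Set.range fun i => Ideal.Quotient.mk (Ideal.span (Set.range f))
      (monomial (a (e.symm i)) (1 : k))) = Set.range ((fun s : ι →₀ ℕ =>
    Ideal.Quotient.mk (Ideal.span (Set.range f)) (monomial s (1 : k))) ∘ a) :=
    e.symm.surjective.range_comp ((fun s : ι →₀ ℕ =>
      Ideal.Quotient.mk (Ideal.span (Set.range f)) (monomial s (1 : k))) ∘ a)
  rw [h1, hspan, eq_top_iff]
  rintro y -
  obtain ⟨b, rfl⟩ := Ideal.Quotient.mk_surjective y
  rw [b.as_sum, map_sum]
  refine sum_mem fun s _ => ?_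
  have : monomial s (coeff s b) = coeff s b • monomial s (1 : k) := by
    rw [smul_monomial, smul_eq_mul, mul_one]
  rw [this, ← Ideal.Quotient.mkₐ_eq_mk k, map_smul]
  exact Submodule.smul_mem _ _ (Submodule.subset_span ⟨s, rfl⟩)

/-- Homogeneous generators of the fibre ring generate over `k[f]`, compatibly with degrees. -/
theorem exists_homogeneous_sum_mul [Fintype τ] {f : ι → MvPolynomial ι k} {d : ι → ℕ}
    (hf : ∀ j, (f j).IsHomogeneous (d j)) (hd : ∀ j, 0 < d j) {e : τ → MvPolynomial ι k}
    {δ : τ → ℕ} (hδ : ∀ i, (e i).IsHomogeneous (δ i))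
    (hspan : Submodule.span k (Set.range fun i =>
        Ideal.Quotient.mk (Ideal.span (Set.range f)) (e i)) = ⊤)
    (n : ℕ) (a : MvPolynomial ι k) (ha : a.IsHomogeneous n) :
    ∃ b : τ → MvPolynomial ι k, (∀ i, b i ∈ Algebra.adjoin k (Set.range f)) ∧
      (∀ i, IsHomogeneousInt (b i) (n - δ i)) ∧ a = ∑ i, b i * e i := by
  classical
  induction n using Nat.strong_induction_on generalizing a with
  | _ n ih =>
    have h1 : Ideal.Quotient.mk (Ideal.span (Set.range f)) a ∈ Submodule.span k (Set.range fun i =>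
        Ideal.Quotient.mk (Ideal.span (Set.range f)) (e i)) := by
      rw [hspan]
      exact Submodule.mem_top
    rw [Submodule.mem_span_range_iff_exists_fun] at h1
    obtain ⟨c, hc⟩ := h1
    have h2 : a - ∑ i, c i • e i ∈ Ideal.span (Set.range f) := by
      rw [← Ideal.Quotient.eq_zero_iff_mem, ← Ideal.Quotient.mkₐ_eq_mk k, map_sub, map_sum,
        sub_eq_zero, Ideal.Quotient.mkₐ_eq_mk, ← hc]
      rfl
    rw [Ideal.mem_span_range_iff_exists_fun] at h2
    obtain ⟨u, hu⟩ := h2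
    -- Only the degree n - d_j part of the coefficient of f_j matters; since d_j > 0, induction
    -- applies to it.
    have h3 : ∀ j, ∃ b : τ → MvPolynomial ι k, (∀ i, b i ∈ Algebra.adjoin k (Set.range f)) ∧
        (∀ i, IsHomogeneousInt (b i) ((n : ℤ) - d j - δ i)) ∧
        (if d j ≤ n then homogeneousComponent (n - d j) (u j) else 0) = ∑ i, b i * e i := by
      intro j
      split_ifs with hj
      · obtain ⟨b, hb, hb', hb''⟩ := ih (n - d j) (by have := hd j; omega) _
          (homogeneousComponent_isHomogeneous (n - d j) (u j))
        refine ⟨b, hb, fun i => ?_, hb''⟩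
        have := hb' i
        rwa [Nat.cast_sub hj] at this
      · exact ⟨0, fun i => zero_mem _, fun i => isHomogeneousInt_zero _, by simp⟩
    choose b hbB hbd hb using h3
    have h4 : a = ∑ i, (if δ i = n then c i else 0) • e i +
        ∑ j, f j * (if d j ≤ n then homogeneousComponent (n - d j) (u j) else 0) := by
      have h5 : a = ∑ i, c i • e i + ∑ j, f j * u j := by
        rw [← sub_eq_iff_eq_add', ← hu]
        exact Finset.sum_congr rfl fun j _ => mul_comm _ _
      have h6 := congrArg (homogeneousComponent n) h5
      rw [homogeneousComponent_eq_self ha, map_add, map_sum, map_sum] at h6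
      rw [h6]
      congr 1
      · refine Finset.sum_congr rfl fun i _ => ?_
        rw [map_smul, homogeneousComponent_of_mem (hδ i)]
        by_cases h : δ i = n
        · simp [h]
        · simp [h, Ne.symm h]
      · refine Finset.sum_congr rfl fun j _ => ?_
        rw [homogeneousComponent_mul_of_isHomogeneous (hf j)]
        split_ifs <;> simp
    refine ⟨fun i => C (if δ i = n then c i else 0) + ∑ j, f j * b j i, fun i => ?_, fun i => ?_, ?_⟩
    · exact add_mem (Subalgebra.algebraMap_mem _ _) (sum_mem fun j _ =>
        mul_mem (Algebra.subset_adjoin ⟨j, rfl⟩) (hbB j i))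
    · refine IsHomogeneousInt.add ?_ (IsHomogeneousInt.sum _ fun j _ => ?_)
      · split_ifs with h
        · rw [h, sub_self]
          exact isHomogeneousInt_iff.2 (isHomogeneous_C ι (c i))
        · rw [C_0]
          exact isHomogeneousInt_zero _
      · have := (isHomogeneousInt_iff.2 (hf j)).mul (hbd j i)
        convert this using 1
        ring
    · rw [h4]
      simp only [add_mul, Finset.sum_add_distrib, ← smul_eq_C_mul]
      congr 1
      simp only [Finset.sum_mul, hb, Finset.mul_sum]
      rw [Finset.sum_comm]
      simp only [mul_assoc]

theorem exists_sum_mul [Fintype τ] {f : ι → MvPolynomial ι k} {d : ι → ℕ}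
    (hf : ∀ j, (f j).IsHomogeneous (d j)) (hd : ∀ j, 0 < d j) {e : τ → MvPolynomial ι k}
    {δ : τ → ℕ} (hδ : ∀ i, (e i).IsHomogeneous (δ i))
    (hspan : Submodule.span k (Set.range fun i =>
        Ideal.Quotient.mk (Ideal.span (Set.range f)) (e i)) = ⊤) (a : MvPolynomial ι k) :
    ∃ b : τ → MvPolynomial ι k, (∀ i, b i ∈ Algebra.adjoin k (Set.range f)) ∧
      a = ∑ i, b i * e i := by
  have h := fun n => exists_homogeneous_sum_mul hf hd hδ hspan n (homogeneousComponent n a)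
    (homogeneousComponent_isHomogeneous n a)
  choose b hb _ hb' using h
  refine ⟨fun i => ∑ n ∈ Finset.range (a.totalDegree + 1), b n i, fun i => sum_mem fun n _ => hb n i,
    ?_⟩
  conv_lhs => rw [← sum_homogeneousComponent a]
  simp only [Finset.sum_mul, hb']
  rw [Finset.sum_comm]

end ExistsFibreBasis

/-! ### The Jacobian determinant -/

section Jacobian

open MvPolynomial

variable {k ι Γ : Type*} [Field k] [Fintype ι] [DecidableEq ι] [Group Γ]

omit [DecidableEq ι] in
theorem pderiv_aeval {κ : Type*} (f : ι → MvPolynomial κ k) (h : MvPolynomial ι k) (l : κ) :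
    pderiv l (aeval f h) = ∑ i, aeval f (pderiv i h) * pderiv l (f i) := by
  classical
  induction h using MvPolynomial.induction_on with
  | C a => simp
  | add g h hg hh => simp only [map_add, hg, hh, add_mul, Finset.sum_add_distrib]
  | mul_X h j hh =>
    simp only [map_mul, aeval_X, pderiv_mul, hh, pderiv_X, map_add, add_mul, Finset.sum_add_distrib]
    congr 1
    · rw [Finset.sum_mul]
      exact Finset.sum_congr rfl fun i _ => by ring
    · rw [Finset.sum_eq_single j]
      · simp
      · intro i _ hij
        simp [hij.symm]
      · exact fun h => absurd (Finset.mem_univ _) h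

/-- The Jacobian matrix. -/
def jacobianMatrix (f : ι → MvPolynomial ι k) : Matrix ι ι (MvPolynomial ι k) :=
  Matrix.of fun i j => pderiv j (f i)

omit [DecidableEq ι] in
-- The chain rule for h(a): derivatives of the coefficients of h are combinations of the ∂f_i,
-- because the coefficients are polynomials in f.
theorem exists_pderiv_aeval_eq {f : ι → MvPolynomial ι k}
    (h : Polynomial (Algebra.adjoin k (Set.range f))) (a : MvPolynomial ι k) :
    ∃ N : ι → MvPolynomial ι k, ∀ l, pderiv l (Polynomial.aeval a h) =
      ∑ i, N i * pderiv l (f i) + Polynomial.aeval a (Polynomial.derivative h) * pderiv l a := by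
  induction h using Polynomial.induction_on' with
  | add g h hg hh =>
    obtain ⟨N, hN⟩ := hg
    obtain ⟨M, hM⟩ := hh
    refine ⟨N + M, fun l => ?_⟩
    simp only [map_add, hN, hM, Pi.add_apply, add_mul, Finset.sum_add_distrib]
    ring
  | monomial n b =>
    obtain ⟨b, hb⟩ := b
    have hb' := hb
    rw [Algebra.adjoin_range_eq_range_aeval] at hb'
    obtain ⟨P, hP⟩ := hb'
    have hP' : aeval f P = b := hP
    refine ⟨fun i => aeval f (pderiv i P) * a ^ n, fun l => ?_⟩
    simp only [Polynomial.aeval_monomial, Polynomial.derivative_monomial, map_mul, map_natCast]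
    have hbb : algebraMap (Algebra.adjoin k (Set.range f)) (MvPolynomial ι k) ⟨b, hb⟩ = b := rfl
    rw [hbb, ← hP', pderiv_mul, pderiv_aeval, pderiv_pow, Finset.sum_mul]
    congr 1
    · exact Finset.sum_congr rfl fun i _ => by ring
    · ring

/-- The Jacobian does not vanish if every variable is a simple root of a polynomial over `k[f]`. -/
theorem det_jacobianMatrix_ne_zero {f : ι → MvPolynomial ι k}
    (h : ∀ a : MvPolynomial ι k, ∃ h : Polynomial (Algebra.adjoin k (Set.range f)),
      Polynomial.aeval a h = 0 ∧ Polynomial.aeval a (Polynomial.derivative h) ≠ 0) :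
    (jacobianMatrix f).det ≠ 0 := by
  choose h h0 h1 using fun j => h (X j)
  choose N hN using fun j => exists_pderiv_aeval_eq (h j) (X j)
  -- Differentiating h_j(X_j) = 0 factors a diagonal matrix with nonzero entries through the
  -- Jacobian matrix.
  have key : Matrix.of N * jacobianMatrix f =
      Matrix.diagonal fun j => -Polynomial.aeval (X j) (Polynomial.derivative (h j)) := by
    ext1 j l
    have := hN j l
    rw [h0, map_zero, pderiv_X] at this
    rw [Matrix.mul_apply, Matrix.diagonal_apply]
    simp only [Matrix.of_apply, jacobianMatrix]
    rw [← sub_eq_zero, eq_comm, this]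
    by_cases hjl : j = l
    · subst hjl
      simp
    · rw [Pi.single_apply, if_neg hjl, mul_zero, add_zero] at this
      simp [hjl, ← this]
  have hdet := congrArg Matrix.det key
  rw [Matrix.det_mul, Matrix.det_diagonal] at hdet
  intro hz
  rw [hz, mul_zero, eq_comm, Finset.prod_eq_zero_iff] at hdet
  obtain ⟨j, -, hj⟩ := hdet
  exact h1 j (neg_eq_zero.1 hj)

/-- The Jacobian of invariants of a `p`-group is invariant. -/
theorem det_jacobianMatrix_mem_fixedSubalgebra (p : ℕ) [Fact p.Prime] [CharP k p]
    (hp : IsPGroup p Γ) {φ : Γ →* (MvPolynomial ι k →ₐ[k] MvPolynomial ι k)}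
    (hφ : IsLinearAction φ) {f : ι → MvPolynomial ι k} (hf : ∀ i, f i ∈ fixedSubalgebra φ)
    (h0 : (jacobianMatrix f).det ≠ 0) : (jacobianMatrix f).det ∈ fixedSubalgebra φ := by
  intro g
  set J := (jacobianMatrix f).det
  -- By the chain rule J changes by the scalar determinant of g. Since g has p-power order, c is a
  -- p-power root of unity, and 1 is the only one in characteristic p.
  obtain ⟨c, hc⟩ : ∃ c : k, J = φ g J * C c := by
    let M : Matrix ι ι k := Matrix.of fun j l => coeff (Finsupp.single l 1) (φ g (X j))
    have hM : ∀ j l, pderiv l (φ g (X j)) = C (M j l) := by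
      intro j l
      conv_lhs => rw [eq_sum_smul_X_of_isHomogeneous_one (hφ g j)]
      rw [map_sum, Finset.sum_eq_single l]
      · rw [Derivation.map_smul, pderiv_X_self, smul_eq_C_mul, mul_one]
        rfl
      · intro i _ hi
        rw [Derivation.map_smul, pderiv_X_of_ne hi, smul_zero]
      · exact fun h => absurd (Finset.mem_univ _) h
    refine ⟨M.det, ?_⟩
    have h1 : jacobianMatrix f = (jacobianMatrix f).map (φ g) * M.map C := by
      ext1 i l
      rw [Matrix.mul_apply]
      simp only [Matrix.map_apply, jacobianMatrix, Matrix.of_apply, ← hM]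
      have hu : ∀ a, φ g a = aeval (fun j => φ g (X j)) a :=
        DFunLike.congr_fun (MvPolynomial.aeval_unique (φ g))
      conv_lhs => rw [← hf i g, hu, pderiv_aeval]
      simp only [← hu]
    have h2 := congrArg Matrix.det h1
    rw [Matrix.det_mul] at h2
    have h3 : ((jacobianMatrix f).map (φ g)).det = φ g J := (AlgHom.map_det (φ g) _).symm
    have h4 : (M.map C).det = (C M.det : MvPolynomial ι k) := (RingHom.map_det C M).symm
    rw [h3, h4] at h2
    exact h2
  have hpow : ∀ n : ℕ, J = φ (g ^ n) J * C (c ^ n) := by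
    intro n
    induction n with
    | zero => simp
    | succ n ih =>
      conv_lhs => rw [hc]
      conv_lhs => rw [ih]
      rw [map_mul, algHom_C, MvPolynomial.algebraMap_eq, ← AlgHom.mul_apply, ← map_mul, ← pow_succ',
        pow_succ c, C_mul]
      ring
  obtain ⟨N, hN⟩ := hp g
  have h1 := hpow (p ^ N)
  rw [hN, map_one, AlgHom.one_apply] at h1
  have h2 : c ^ p ^ N = 1 := by
    have h3 : J * C (c ^ p ^ N) = J * C 1 := by rw [← h1, C_1, mul_one]
    exact C_injective ι k (mul_left_cancel₀ h0 h3)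
  have hc1 : c = 1 := by
    have : ExpChar k p := ExpChar.prime Fact.out
    refine iterateFrobenius_inj k p N ?_
    rw [iterateFrobenius_def, iterateFrobenius_def, h2, one_pow]
  rw [hc1, C_1, mul_one] at hc
  exact hc.symm

end Jacobian

end InvariantTheory

end


noncomputable section

namespace InvariantTheory

/-! ### The Bezoutian on the graphs of group elements -/

section Bezoutian

open MvPolynomial

variable {k ι τ Γ : Type*} [Field k] [Fintype ι] [Group Γ]

omit [Fintype ι] in
theorem rename_inl_sub_rename_inr_mem (f : MvPolynomial ι k) :
    rename Sum.inl f - rename Sum.inr f ∈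
      Ideal.span (Set.range fun j : ι => (X (.inl j) - X (.inr j) : MvPolynomial (ι ⊕ ι) k)) := by
  set I := Ideal.span (Set.range fun j : ι => (X (.inl j) - X (.inr j) : MvPolynomial (ι ⊕ ι) k))
  have : (Ideal.Quotient.mkₐ k I).comp (rename Sum.inl) =
      (Ideal.Quotient.mkₐ k I).comp (rename Sum.inr) := by
    refine MvPolynomial.algHom_ext fun j => ?_
    simp only [AlgHom.comp_apply, rename_X]
    exact Ideal.Quotient.eq.2 (Ideal.subset_span ⟨j, rfl⟩)
  exact Ideal.Quotient.eq.1 (DFunLike.congr_fun this f)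

theorem exists_isHomogeneous_difference_quotient {f : MvPolynomial ι k} {d : ℕ}
    (hf : f.IsHomogeneous d) (hd : 0 < d) :
    ∃ D : ι → MvPolynomial (ι ⊕ ι) k, (∀ j, (D j).IsHomogeneous (d - 1)) ∧
      rename Sum.inl f - rename Sum.inr f = ∑ j, D j * (X (.inl j) - X (.inr j)) := by
  have h := rename_inl_sub_rename_inr_mem f
  rw [Ideal.mem_span_range_iff_exists_fun] at h
  obtain ⟨D, hD⟩ := h
  refine ⟨fun j => homogeneousComponent (d - 1) (D j), fun j =>
    homogeneousComponent_isHomogeneous _ _, ?_⟩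
  have h1 := congrArg (homogeneousComponent d) hD
  rw [homogeneousComponent_eq_self ((hf.rename_isHomogeneous).sub hf.rename_isHomogeneous),
    map_sum] at h1
  rw [← h1]
  refine Finset.sum_congr rfl fun j _ => ?_
  rw [mul_comm, homogeneousComponent_mul_of_isHomogeneous
    ((isHomogeneous_X k (Sum.inl j)).sub (isHomogeneous_X k (Sum.inr j))), if_pos (Nat.one_le_iff_ne_zero.2 hd.ne'), mul_comm]

/-- The evaluation `F(x, y) ↦ F(g x, x)`. -/
def twistedDiagonal (φ : Γ →* (MvPolynomial ι k →ₐ[k] MvPolynomial ι k)) (g : Γ) :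
    MvPolynomial (ι ⊕ ι) k →ₐ[k] MvPolynomial ι k :=
  aeval (Sum.elim (fun i => φ g (X i)) X)

variable {φ : Γ →* (MvPolynomial ι k →ₐ[k] MvPolynomial ι k)}

omit [Fintype ι] in
theorem twistedDiagonal_rename_inl (g : Γ) (a : MvPolynomial ι k) :
    twistedDiagonal φ g (rename Sum.inl a) = φ g a := by
  have : (twistedDiagonal φ g).comp (rename Sum.inl) = φ g := by
    refine MvPolynomial.algHom_ext fun i => ?_
    simp [twistedDiagonal]
  exact DFunLike.congr_fun this a

omit [Fintype ι] in
theorem twistedDiagonal_rename_inr (g : Γ) (a : MvPolynomial ι k) :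
    twistedDiagonal φ g (rename Sum.inr a) = a := by
  have : (twistedDiagonal φ g).comp (rename Sum.inr) = AlgHom.id k _ := by
    refine MvPolynomial.algHom_ext fun i => ?_
    simp [twistedDiagonal]
  exact DFunLike.congr_fun this a

omit [Fintype ι] in
theorem pderiv_inl_rename_inr (f : MvPolynomial ι k) (l : ι) :
    pderiv (Sum.inl l) (rename (Sum.inr : ι → ι ⊕ ι) f) = 0 := by
  classical
  refine pderiv_eq_zero_of_notMem_vars fun h => ?_
  have := vars_rename (Sum.inr : ι → ι ⊕ ι) f h
  simp at this

/-- The Bezoutian of invariants restricts to zero on the graph of every `g ≠ 1`, and to the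
Jacobian on the diagonal. -/
theorem exists_bezoutian [DecidableEq ι] (hinj : Function.Injective φ) {f : ι → MvPolynomial ι k}
    {d : ι → ℕ} (hf : ∀ i, f i ∈ fixedSubalgebra φ) (hfd : ∀ i, (f i).IsHomogeneous (d i))
    (hd : ∀ i, 0 < d i) :
    ∃ D : MvPolynomial (ι ⊕ ι) k, D.IsHomogeneous (∑ i, (d i - 1)) ∧
      (∀ g ≠ 1, twistedDiagonal φ g D = 0) ∧
      twistedDiagonal φ 1 D = (jacobianMatrix f).det := by
  choose Δ hΔd hΔ using fun i => exists_isHomogeneous_difference_quotient (hfd i) (hd i)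
  refine ⟨(Matrix.of Δ).det, ?_, fun g hg => ?_, ?_⟩
  · rw [Matrix.det_apply]
    refine IsHomogeneous.sum _ _ _ fun π _ => ?_
    have h1 : (∏ i, Matrix.of Δ (π i) i).IsHomogeneous (∑ i, (d i - 1)) := by
      rw [← Equiv.sum_comp π]
      exact IsHomogeneous.prod _ _ _ fun i _ => hΔd _ _
    rcases Int.units_eq_one_or (Equiv.Perm.sign π) with h | h
    · rwa [h, one_smul]
    · rw [h, Units.neg_smul, one_smul]
      exact h1.neg
  · rw [AlgHom.map_det]
    rw [← Matrix.exists_mulVec_eq_zero_iff]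
    -- Since f_i(gx) = f_i(x), the vector gx - x lies in the kernel of the difference quotients at
    -- (gx, x); it is nonzero because the action is faithful.
    refine ⟨fun j => φ g (X j) - X j, fun h => hg (hinj (MvPolynomial.algHom_ext fun j => ?_)), ?_⟩
    · have := congrFun h j
      rw [map_one, AlgHom.one_apply]
      exact sub_eq_zero.1 this
    · ext1 i
      have h1 := congrArg (twistedDiagonal φ g) (hΔ i)
      rw [map_sub, twistedDiagonal_rename_inl, twistedDiagonal_rename_inr, hf i g, sub_self,
        map_sum] at h1
      rw [Pi.zero_apply, h1]
      simp [Matrix.mulVec, dotProduct, twistedDiagonal]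
  · rw [AlgHom.map_det]
    congr 1
    ext1 i l
    -- After differentiating in the first set of variables and restricting to the diagonal, only the
    -- terms where the factor x_j - y_j was differentiated survive.
    have h1 := congrArg (fun F => twistedDiagonal φ 1 (pderiv (Sum.inl l) F)) (hΔ i)
    simp only [map_sub, map_sum, pderiv_inl_rename_inr, sub_zero,
      pderiv_rename Sum.inl_injective, twistedDiagonal_rename_inl, pderiv_mul, map_add, map_mul,
      map_one, AlgHom.one_apply] at h1
    change twistedDiagonal φ 1 (Δ i l) = pderiv l (f i)
    rw [h1, Finset.sum_eq_single l]
    · simp [twistedDiagonal]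
    · intro j _ hj
      simp [twistedDiagonal, hj]
    · exact fun h => absurd (Finset.mem_univ _) h

/-- Expanding a form in two sets of variables along homogeneous generators of each. -/
theorem exists_sum_twistedDiagonal [Fintype τ] {B : Subalgebra k (MvPolynomial ι k)}
    (hB : B ≤ fixedSubalgebra φ) {e : τ → MvPolynomial ι k} {δ : τ → ℕ}
    (hspan : ∀ n, ∀ a : MvPolynomial ι k, a.IsHomogeneous n → ∃ b : τ → MvPolynomial ι k,
      (∀ i, b i ∈ B) ∧ (∀ i, IsHomogeneousInt (b i) (n - δ i)) ∧ a = ∑ i, b i * e i)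
    {σ : ℕ} {D : MvPolynomial (ι ⊕ ι) k} (hD : D.IsHomogeneous σ) :
    ∃ c : τ → τ → MvPolynomial ι k, (∀ i j, c i j ∈ B) ∧
      (∀ i j, IsHomogeneousInt (c i j) ((σ : ℤ) - δ i - δ j)) ∧
      ∀ g, twistedDiagonal φ g D = ∑ i, ∑ j, c i j * φ g (e i) * e j := by
  classical
  have hmono : ∀ s : ι ⊕ ι →₀ ℕ, ∃ c : τ → τ → MvPolynomial ι k, s ∈ D.support →
      (∀ i j, c i j ∈ B) ∧ (∀ i j, IsHomogeneousInt (c i j) ((σ : ℤ) - δ i - δ j)) ∧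
      ∀ g, twistedDiagonal φ g (monomial s (coeff s D)) =
        ∑ i, ∑ j, c i j * φ g (e i) * e j := by
    intro s
    by_cases hs : s ∈ D.support
    swap
    · exact ⟨0, fun h => absurd h hs⟩
    let a₁ : MvPolynomial ι k := C (coeff s D) * ∏ i, X i ^ s (.inl i)
    let a₂ : MvPolynomial ι k := ∏ i, X i ^ s (.inr i)
    have h₁ : a₁.IsHomogeneous (0 + ∑ i, 1 * s (.inl i)) :=
      (isHomogeneous_C ι _).mul (IsHomogeneous.prod _ _ _ fun i _ => (isHomogeneous_X k i).pow _)
    have h₂ : a₂.IsHomogeneous (∑ i, 1 * s (.inr i)) :=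
      IsHomogeneous.prod _ _ _ fun i _ => (isHomogeneous_X k i).pow _
    have hmon : monomial s (coeff s D) = rename Sum.inl a₁ * rename Sum.inr a₂ := by
      rw [monomial_eq, Finsupp.prod_fintype _ _ (by simp), Fintype.prod_sum_type]
      simp [a₁, a₂, mul_assoc]
    have hdeg : (0 + ∑ i, 1 * s (.inl i)) + ∑ i, 1 * s (.inr i) = σ := by
      have h3 := isHomogeneousInt_iff.2 hD s (mem_support_iff.1 hs)
      rw [Nat.cast_inj, Finsupp.degree_eq_sum, Fintype.sum_sum_type] at h3
      simpa using h3
    obtain ⟨b₁, hb₁, hb₁d, hb₁e⟩ := hspan _ _ h₁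
    obtain ⟨b₂, hb₂, hb₂d, hb₂e⟩ := hspan _ _ h₂
    refine ⟨fun i j => b₁ i * b₂ j, fun _ => ⟨fun i j => mul_mem (hb₁ i) (hb₂ j), fun i j => ?_,
      fun g => ?_⟩⟩
    · have h3 := (hb₁d i).mul (hb₂d j)
      have h4 : ((0 + ∑ i, 1 * s (.inl i) : ℕ) : ℤ) + ((∑ i, 1 * s (.inr i) : ℕ) : ℤ) = σ := by
        exact_mod_cast hdeg
      convert h3 using 1
      rw [← h4]
      ring
    · rw [hmon, map_mul, twistedDiagonal_rename_inl, twistedDiagonal_rename_inr]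
      conv_lhs => rw [hb₁e, hb₂e]
      rw [map_sum, Finset.sum_mul_sum]
      refine Finset.sum_congr rfl fun i _ => Finset.sum_congr rfl fun j _ => ?_
      rw [map_mul, hB (hb₁ i) g]
      ring
  choose c hc using hmono
  refine ⟨fun i j => ∑ s ∈ D.support, c s i j, fun i j => sum_mem fun s hs => (hc s hs).1 i j,
    fun i j => IsHomogeneousInt.sum _ fun s hs => (hc s hs).2.1 i j, fun g => ?_⟩
  conv_lhs => rw [D.as_sum, map_sum]
  rw [Finset.sum_congr rfl fun s hs => (hc s hs).2.2 g, Finset.sum_comm]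
  refine Finset.sum_congr rfl fun i _ => ?_
  rw [Finset.sum_comm]
  exact Finset.sum_congr rfl fun j _ => by simp only [Finset.sum_mul]

end Bezoutian

/-! ### Polynomial invariants have a principal transfer ideal -/

section TransferPrincipal

open MvPolynomial

variable {k ι Γ : Type*} [Field k] [Group Γ]

theorem degree_pos_of_algebraicIndependent {f : ι → MvPolynomial ι k} {d : ι → ℕ}
    (hf : ∀ i, (f i).IsHomogeneous (d i)) (hai : AlgebraicIndependent k f) (i : ι) : 0 < d i := by
  rw [Nat.pos_iff_ne_zero]
  intro h0
  have h1 := hf i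
  rw [h0, ← totalDegree_zero_iff_isHomogeneous] at h1
  have h2 := totalDegree_eq_zero_iff_eq_C.1 h1
  have h3 : aeval f (X i - C (coeff 0 (f i)) : MvPolynomial ι k) = 0 := by
    rw [map_sub, aeval_X, algHom_C, MvPolynomial.algebraMap_eq, ← h2, sub_self]
  have h4 := (algebraicIndependent_iff.1 hai) _ h3
  have h5 := congrArg totalDegree (sub_eq_zero.1 h4)
  rw [totalDegree_X, totalDegree_C] at h5
  exact one_ne_zero h5

/-- If the invariants of a `p`-group form a polynomial ring, its transfer ideal is principal. -/
theorem exists_generator_of_algebraicIndependent [Fintype ι] [Fintype Γ] (p : ℕ) [Fact p.Prime]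
    [CharP k p] (hp : IsPGroup p Γ)
    {φ : Γ →* (MvPolynomial ι k →ₐ[k] MvPolynomial ι k)} (hφ : IsLinearAction φ)
    (hinj : Function.Injective φ) {f : ι → MvPolynomial ι k}
    (hfh : ∀ i, ∃ d : ℕ, (f i).IsHomogeneous d) (hai : AlgebraicIndependent k f)
    (hadj : Algebra.adjoin k (Set.range f) = fixedSubalgebra φ) :
    ∃ J ∈ fixedSubalgebra φ, (∃ a, ∑ g, φ g a = J) ∧
      ∀ a, ∃ b ∈ fixedSubalgebra φ, ∑ g, φ g a = J * b := by
  classical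
  choose d hfd using hfh
  have hd := degree_pos_of_algebraicIndependent hfd hai
  have hf : ∀ i, f i ∈ fixedSubalgebra φ := fun i => hadj ▸ Algebra.subset_adjoin ⟨i, rfl⟩
  have hint : Algebra.IsIntegral (Algebra.adjoin k (Set.range f)) (MvPolynomial ι k) :=
    hadj ▸ isIntegral_fixedSubalgebra φ
  obtain ⟨μ, s, hli, hspan⟩ := exists_monomial_fibre_basis (finite_quotient_of_isIntegral hfd hd hint)
  set e : Fin μ → MvPolynomial ι k := fun i => monomial (s i) 1 with he
  set δ : Fin μ → ℕ := fun i => (s i).degree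
  have hδ : ∀ i, (e i).IsHomogeneous (δ i) := fun i => isHomogeneous_monomial _ rfl
  have hgen := exists_sum_mul hfd hd hδ hspan
  have hgenh := exists_homogeneous_sum_mul hfd hd hδ hspan
  have hE := two_mul_sum_degree_eq p f e hfd hδ hli hgen
  rw [hadj] at hgen hgenh
  have hind : ∀ b : Fin μ → MvPolynomial ι k, (∀ i, b i ∈ fixedSubalgebra φ) →
      ∑ i, b i * e i = 0 → ∀ i, b i = 0 := by
    intro b hb h0 i
    have h1 : ∀ i, ∃ P : MvPolynomial ι k, aeval f P = b i := by
      intro i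
      have := hb i
      rw [← hadj, Algebra.adjoin_range_eq_range_aeval] at this
      exact this
    choose P hP using h1
    rw [← hP i, eq_zero_of_sum_aeval_mul_eq_zero p f e hli (by rw [hadj]; exact hgen) P
      (by simpa only [hP] using h0) i, map_zero]
  set J := (jacobianMatrix f).det with hJ
  have hJ0 : J ≠ 0 := by
    refine det_jacobianMatrix_ne_zero fun a => ?_
    rw [hadj]
    obtain ⟨h, -, h0, h1⟩ := exists_monic_aeval_eq_zero φ a
    exact ⟨h, h0, h1⟩
  have hJB : J ∈ fixedSubalgebra φ := det_jacobianMatrix_mem_fixedSubalgebra p hp hφ hf hJ0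
  obtain ⟨D, hDd, hD1, hDJ⟩ := exists_bezoutian hinj hf hfd hd
  obtain ⟨c, hcB, hcd, hc⟩ := exists_sum_twistedDiagonal (φ := φ) le_rfl hgenh hDd
  let T : Matrix (Fin μ) (Fin μ) (fixedSubalgebra φ) :=
    Matrix.of fun i j => ⟨∑ g, φ g (e i * e j), sum_mem_fixedSubalgebra _⟩
  let M : Matrix (Fin μ) (Fin μ) (fixedSubalgebra φ) := Matrix.of fun i j => ⟨c i j, hcB i j⟩
  let J' : fixedSubalgebra φ := ⟨J, hJB⟩
  -- Two evaluations of Σ_g g(e_i) D(gx, x): only g = 1 contributes, while expanding D produces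
  -- transfers of e_i e_l. Comparing coefficients of e_j then gives `hTM`.
  have hsum : ∀ i, ∑ j, (∑ l, (∑ g, φ g (e i * e l)) * c l j) * e j = J * e i := by
    intro i
    have h1 : ∀ g, φ g (e i) * twistedDiagonal φ g D = if g = 1 then J * e i else 0 := by
      intro g
      split_ifs with hg
      · rw [hg, hDJ, map_one, AlgHom.one_apply, mul_comm]
      · rw [hD1 g hg, mul_zero]
    have h2 : ∑ g, φ g (e i) * twistedDiagonal φ g D = J * e i := by
      simp only [h1, Finset.sum_ite_eq', Finset.mem_univ, if_true]
    rw [← h2]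
    simp only [hc, Finset.sum_mul, Finset.mul_sum, map_mul]
    rw [Finset.sum_congr rfl fun j _ => Finset.sum_comm, Finset.sum_comm]
    refine Finset.sum_congr rfl fun g _ => ?_
    rw [Finset.sum_comm]
    refine Finset.sum_congr rfl fun l _ => Finset.sum_congr rfl fun j _ => ?_
    ring
  have hTM : T * M = J' • (1 : Matrix (Fin μ) (Fin μ) (fixedSubalgebra φ)) := by
    ext1 i j
    have h1 := hind (fun j => (((T * M) i j : fixedSubalgebra φ) : MvPolynomial ι k) -
      if i = j then J else 0) (fun j => sub_mem (Subtype.property _) (by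
        split_ifs
        · exact hJB
        · exact zero_mem _)) (by
      simp only [sub_mul, Finset.sum_sub_distrib, ite_mul, zero_mul, Finset.sum_ite_eq,
        Finset.mem_univ, if_true]
      rw [sub_eq_zero, ← hsum i]
      simp [T, M, Matrix.mul_apply]) j
    refine Subtype.ext ?_
    rw [sub_eq_zero.1 h1, Matrix.smul_apply, Matrix.one_apply]
    split_ifs
    · simp [J']
    · simp
  have hdetM : IsUnit M.det := by
    have h1 : M.det ≠ 0 := by
      intro h0
      have := congrArg Matrix.det hTM
      rw [Matrix.det_mul, h0, mul_zero, Matrix.det_smul, Matrix.det_one, mul_one, eq_comm] at this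
      exact pow_ne_zero _ (fun h => hJ0 (congrArg Subtype.val h)) this
    have h2 : IsHomogeneousInt (M.det : MvPolynomial ι k) 0 := by
      have h3 : (M.det : MvPolynomial ι k) = (Matrix.of c).det :=
        (AlgHom.map_det (fixedSubalgebra φ).val M)
      rw [h3, Matrix.det_apply]
      refine IsHomogeneousInt.sum _ fun π _ => ?_
      have h4 : IsHomogeneousInt (∏ i, Matrix.of c (π i) i)
          (∑ i, (((∑ l, (d l - 1) : ℕ) : ℤ) - δ (π i) - δ i)) :=
        IsHomogeneousInt.prod _ fun i _ => hcd _ _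
      -- Every term of det M has degree μ Σ (d_l - 1) - 2 Σ δ_i, which is 0 by `hE`.
      have h5 : ∑ i, (((∑ l, (d l - 1) : ℕ) : ℤ) - δ (π i) - δ i) = 0 := by
        rw [Finset.sum_sub_distrib, Finset.sum_sub_distrib, Equiv.sum_comp π fun i => (δ i : ℤ)]
        have h6 : ((∑ l, (d l - 1) : ℕ) : ℤ) = ∑ l, ((d l : ℤ) - 1) := by
          rw [Nat.cast_sum]
          exact Finset.sum_congr rfl fun l _ => by have := hd l; omega
        rw [h6, Finset.sum_const, Finset.card_univ, nsmul_eq_mul, ← hE]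
        ring
      rw [h5] at h4
      rcases Int.units_eq_one_or (Equiv.Perm.sign π) with h | h
      · rwa [h, one_smul]
      · rw [h, Units.neg_smul, one_smul]
        exact h4.neg
    have h7 := h2.eq_C
    have h8 : M.det = algebraMap k (fixedSubalgebra φ) (coeff 0 (M.det : MvPolynomial ι k)) :=
      Subtype.ext h7
    rw [h8]
    refine (IsUnit.mk0 _ fun h9 => h1 ?_).map _
    rw [h8, h9, map_zero]
  have hT : T = J' • M⁻¹ := by
    rw [← Matrix.mul_one T, ← Matrix.mul_nonsing_inv M hdetM, ← Matrix.mul_assoc, hTM,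
      Matrix.smul_mul, Matrix.one_mul]
  have hMT : M * T = J' • (1 : Matrix (Fin μ) (Fin μ) (fixedSubalgebra φ)) := by
    rw [hT, Matrix.mul_smul, Matrix.mul_nonsing_inv M hdetM]
  have hbil : ∀ (b b' : Fin μ → MvPolynomial ι k), (∀ i, b i ∈ fixedSubalgebra φ) →
      (∀ i, b' i ∈ fixedSubalgebra φ) → ∑ g, φ g ((∑ i, b i * e i) * ∑ j, b' j * e j) =
      ∑ i, ∑ j, b i * b' j * (T i j : MvPolynomial ι k) := by
    intro b b' hb hb'
    have : ∀ g, φ g ((∑ i, b i * e i) * ∑ j, b' j * e j) =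
        ∑ i, ∑ j, b i * b' j * φ g (e i * e j) := by
      intro g
      rw [Finset.sum_mul_sum, map_sum]
      refine Finset.sum_congr rfl fun i _ => ?_
      rw [map_sum]
      refine Finset.sum_congr rfl fun j _ => ?_
      simp only [map_mul, hb i g, hb' j g]
      ring
    simp only [this]
    rw [Finset.sum_comm]
    refine Finset.sum_congr rfl fun i _ => ?_
    rw [Finset.sum_comm]
    exact Finset.sum_congr rfl fun j _ => by rw [← Finset.mul_sum]; rfl
  -- Expanding 1 as well writes every a as a product a·1, to which the bilinear formula `hbil`
  -- applies.
  obtain ⟨b₁, hb₁, h1e⟩ := hgen 1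
  refine ⟨J, hJB, ?_, fun a => ?_⟩
  · obtain ⟨i₀⟩ : Nonempty (Fin μ) := by
      by_contra hne
      rw [not_nonempty_iff] at hne
      rw [Fintype.sum_empty] at h1e
      exact one_ne_zero h1e
    have h1 := congrArg (fun N => ((N i₀ i₀ : fixedSubalgebra φ) : MvPolynomial ι k)) hMT
    refine ⟨(∑ l, c i₀ l * e l) * e i₀, ?_⟩
    have h2 : e i₀ = ∑ j, (Pi.single i₀ 1 : Fin μ → MvPolynomial ι k) j * e j := by
      simp [Pi.single_apply]
    rw [h2, hbil _ _ (hcB i₀) (fun j => by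
      rw [Pi.single_apply]
      split_ifs
      · exact one_mem _
      · exact zero_mem _)]
    simpa [Matrix.mul_apply, M, Pi.single_apply, J'] using h1
  · obtain ⟨b, hb, hab⟩ := hgen a
    refine ⟨∑ i, ∑ j, b i * b₁ j * (M⁻¹ i j : MvPolynomial ι k), sum_mem fun i _ => sum_mem fun j _ =>
      mul_mem (mul_mem (hb i) (hb₁ j)) (Subtype.property _), ?_⟩
    have h1 : a = (∑ i, b i * e i) * ∑ j, b₁ j * e j := by rw [← hab, ← h1e, mul_one]
    rw [h1, hbil b b₁ hb hb₁, hT, Finset.mul_sum]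
    refine Finset.sum_congr rfl fun i _ => ?_
    rw [Finset.mul_sum]
    refine Finset.sum_congr rfl fun j _ => ?_
    simp [J']
    ring

end TransferPrincipal

end InvariantTheory

end


noncomputable section

namespace InvariantTheory

/-! ### Commuting unipotent reflections -/

section LinearAlgebra

variable {k M Γ : Type*} [Field k] [AddCommGroup M] [Module k M] [Group Γ]

/-- w is an eigenvector unless it is zero, and nilpotency makes the eigenvalue 0. -/
theorem apply_apply_eq_zero_of_range_le {N : Module.End k M} {w : M}
    (hw : ∀ x, ∃ c : k, N x = c • w) {n : ℕ} (hn : N ^ n = 0) (x : M) : N (N x) = 0 := by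
  obtain ⟨c, hc⟩ := hw w
  obtain ⟨a, ha⟩ := hw x
  have h1 : ∀ m : ℕ, (N ^ m) w = c ^ m • w := by
    intro m
    induction m with
    | zero => simp
    | succ m ih => rw [pow_succ', Module.End.mul_apply, ih, map_smul, hc, smul_smul, pow_succ]
  have h2 := h1 n
  rw [hn, LinearMap.zero_apply, eq_comm, smul_eq_zero] at h2
  rw [ha, map_smul, hc]
  rcases h2 with h | h
  · have hc0 : c = 0 := by
      by_contra hc0
      exact pow_ne_zero n hc0 h
    simp [hc0]
  · simp [h]

/-- If N N' x = N' N x were nonzero it would span the line of w', so w' would lie in the image of N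
and be killed by N. But N' x is a multiple of w'. -/
theorem apply_apply_eq_zero_of_commute {N N' : Module.End k M} {w w' : M}
    (hw : ∀ x, ∃ c : k, N x = c • w) (hw' : ∀ x, ∃ c : k, N' x = c • w')
    (hN : ∀ x, N (N x) = 0) (hcomm : ∀ x, N (N' x) = N' (N x)) (x : M) : N (N' x) = 0 := by
  by_contra hne
  obtain ⟨a, ha⟩ := hw (N' x)
  obtain ⟨b, hb⟩ := hw' (N x)
  obtain ⟨c, hc⟩ := hw' x
  rw [← hcomm] at hb
  have hb0 : b ≠ 0 := by
    rintro rfl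
    exact hne (by rw [hb, zero_smul])
  refine hne ?_
  have h1 : w' = b⁻¹ • N (N' x) := by rw [hb, inv_smul_smul₀ hb0]
  rw [hc, h1, map_smul, map_smul, hN, smul_zero, smul_zero]

/-- An abelian unipotent group generated by elements of rank at most one acts trivially on the
images of all `ρ h - 1`. -/
theorem map_sub_eq_self_of_closure_eq_top (ρ : Γ →* Module.End k M)
    (hcomm : ∀ g h : Γ, g * h = h * g) (hnil : ∀ g, ∃ n : ℕ, (ρ g - 1) ^ n = 0) {S : Set Γ}
    (hS : ∀ σ ∈ S, ∃ w, ∀ x, ∃ c : k, ρ σ x - x = c • w) (htop : Subgroup.closure S = ⊤)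
    (g h : Γ) (x : M) : ρ g (ρ h x - x) = ρ h x - x := by
  have hmul : ∀ (a b : Γ) (y : M), ρ (a * b) y = ρ a (ρ b y) := fun a b y => by
    rw [map_mul, Module.End.mul_apply]
  have h1 : ∀ σ ∈ S, ∀ τ ∈ S, ∀ x, ρ σ (ρ τ x - x) = ρ τ x - x := by
    intro σ hσ τ hτ x
    obtain ⟨w, hw⟩ := hS σ hσ
    obtain ⟨w', hw'⟩ := hS τ hτ
    obtain ⟨n, hn⟩ := hnil σ
    have := apply_apply_eq_zero_of_commute (N := ρ σ - 1) (N' := ρ τ - 1) hw hw'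
      (apply_apply_eq_zero_of_range_le hw hn) (fun y => by
        simp only [LinearMap.sub_apply, Module.End.one_apply, map_sub]
        rw [← hmul, ← hmul, hcomm]
        abel) x
    exact sub_eq_zero.1 this
  have hmem : ∀ g, g ∈ Subgroup.closure S := fun g => htop ▸ Subgroup.mem_top g
  have h2 : ∀ τ ∈ S, ∀ g x, ρ g (ρ τ x - x) = ρ τ x - x := by
    intro τ hτ g x
    induction hmem g using Subgroup.closure_induction with
    | mem σ hσ => exact h1 σ hσ τ hτ x
    | one => simp
    | mul a b _ _ ha hb => rw [hmul, hb, ha]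
    | inv a _ ha =>
      conv_lhs => rw [← ha]
      rw [← hmul]
      simp
  induction hmem h using Subgroup.closure_induction generalizing x with
  | mem τ hτ => exact h2 τ hτ g x
  | one => simp
  | mul a b _ _ ha hb =>
    have : ρ (a * b) x - x = (ρ a (ρ b x) - ρ b x) + (ρ b x - x) := by
      rw [hmul]
      abel
    rw [this, map_add, ha, hb]
  | inv a _ ha =>
    have : ρ a⁻¹ x - x = -(ρ a (ρ a⁻¹ x) - ρ a⁻¹ x) := by
      rw [← hmul]
      simp
    rw [this, map_neg, ha]

theorem exists_basis_sum_of_submodule [FiniteDimensional k M] (F : Submodule k M) :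
    ∃ (m r : ℕ) (b : Module.Basis (Fin m ⊕ Fin r) k M), (∀ i, b (.inl i) ∈ F) ∧
      ∀ x ∈ F, ∃ c : Fin m → k, x = ∑ i, c i • b (.inl i) := by
  obtain ⟨W, hW⟩ := Submodule.exists_isCompl F
  let bF := Module.finBasis k F
  let bW := Module.finBasis k W
  let b := (bF.prod bW).map (Submodule.prodEquivOfIsCompl F W hW)
  have hb : ∀ i, b (.inl i) = bF i := by
    intro i
    simp [b]
  refine ⟨_, _, b, fun i => ?_, fun x hx => ⟨fun i => bF.repr ⟨x, hx⟩ i, ?_⟩⟩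
  · rw [hb]
    exact (bF i).2
  · have := congrArg F.subtype (bF.sum_repr ⟨x, hx⟩)
    rw [map_sum] at this
    refine this.symm.trans (Finset.sum_congr rfl fun i _ => ?_)
    rw [map_smul, hb, Submodule.subtype_apply]

end LinearAlgebra

/-! ### Transport from the symmetric algebra to polynomials in a basis of linear forms -/

section Transport

open MvPolynomial

variable {k V κ : Type*} [Field k] [AddCommGroup V] [Module k V]
  (G : Subgroup (LinearMap.GeneralLinearGroup k V)) (b : Module.Basis κ k (Module.Dual k V))

/-- The contragredient representation of `G`. -/
def dualRep : G →* Module.End k (Module.Dual k V) :=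
  ((tautologicalRep (k := k) (V := V)).dual).comp G.subtype

theorem coordAction_ι (σ : G) (x : Module.Dual k V) :
    coordAction (σ : LinearMap.GeneralLinearGroup k V) (SymmetricAlgebra.ι k _ x) =
      SymmetricAlgebra.ι k _ (dualRep G σ x) := by
  simp [coordAction, dualRep]

theorem dualRep_injective [FiniteDimensional k V] : Function.Injective (dualRep G) := by
  intro g h hgh
  have h1 : ∀ v : V, ((g⁻¹ : G) : LinearMap.GeneralLinearGroup k V).1 v =
      ((h⁻¹ : G) : LinearMap.GeneralLinearGroup k V).1 v := by
    intro v
    rw [← sub_eq_zero, ← Module.forall_dual_apply_eq_zero_iff k]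
    intro x
    have := LinearMap.congr_fun (LinearMap.congr_fun hgh x) v
    rw [map_sub, sub_eq_zero]
    exact this
  have h2 : (g⁻¹ : G) = h⁻¹ := Subtype.ext (Units.ext (LinearMap.ext h1))
  exact inv_injective h2

/-- The action of `G` on the polynomial ring in a basis of linear forms. -/
def polyAction : G →* (MvPolynomial κ k →ₐ[k] MvPolynomial κ k) where
  toFun g := ((SymmetricAlgebra.equivMvPolynomial b : CoordinateRing k V →ₐ[k] MvPolynomial κ k).comp
    (coordAction (g : LinearMap.GeneralLinearGroup k V))).comp
      (SymmetricAlgebra.equivMvPolynomial b).symm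
  map_one' := by
    ext
    simp
  map_mul' g h := by
    refine AlgHom.ext fun a => ?_
    simp

theorem polyAction_equivMvPolynomial (g : G) (a : CoordinateRing k V) :
    polyAction G b g (SymmetricAlgebra.equivMvPolynomial b a) =
      SymmetricAlgebra.equivMvPolynomial b
        (coordAction (g : LinearMap.GeneralLinearGroup k V) a) := by
  simp [polyAction]

/-- The linear form attached to a dual vector. -/
def linearForm : Module.Dual k V →ₗ[k] MvPolynomial κ k :=
  (SymmetricAlgebra.equivMvPolynomial b).toLinearMap ∘ₗ SymmetricAlgebra.ι k _

theorem linearForm_basis (i : κ) : linearForm b (b i) = X i := by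
  simp [linearForm]

theorem linearForm_eq_sum [Fintype κ] (x : Module.Dual k V) :
    linearForm b x = ∑ i, b.repr x i • X i := by
  conv_lhs => rw [← b.sum_repr x]
  rw [map_sum]
  simp only [map_smul, linearForm_basis]

theorem linearForm_injective [Fintype κ] : Function.Injective (linearForm b) := by
  classical
  intro x y h
  refine b.repr.injective (Finsupp.ext fun i => ?_)
  have := congrArg (coeff (Finsupp.single i 1)) h
  simpa [linearForm_eq_sum, coeff_sum, coeff_smul, coeff_X, Finsupp.single_left_inj] using this

theorem isHomogeneous_linearForm [Fintype κ] (x : Module.Dual k V) :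
    (linearForm b x).IsHomogeneous 1 := by
  rw [linearForm_eq_sum]
  refine IsHomogeneous.sum _ _ _ fun i _ => ?_
  rw [smul_eq_C_mul]
  exact isHomogeneous_C_mul_X _ _

theorem polyAction_linearForm (g : G) (x : Module.Dual k V) :
    polyAction G b g (linearForm b x) = linearForm b (dualRep G g x) := by
  have := polyAction_equivMvPolynomial G b g (SymmetricAlgebra.ι k _ x)
  rw [coordAction_ι] at this
  exact this

theorem polyAction_X (g : G) (i : κ) :
    polyAction G b g (X i) = linearForm b (dualRep G g (b i)) := by
  rw [← linearForm_basis b i, polyAction_linearForm]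

theorem isLinearAction_polyAction [Fintype κ] : IsLinearAction (polyAction G b) := by
  intro g i
  rw [polyAction_X]
  exact isHomogeneous_linearForm b _

theorem polyAction_injective [Fintype κ] [FiniteDimensional k V] :
    Function.Injective (polyAction G b) := by
  intro g h hgh
  refine dualRep_injective G (LinearMap.ext fun x => linearForm_injective b ?_)
  rw [← polyAction_linearForm, ← polyAction_linearForm, hgh]

theorem equivMvPolynomial_mem_fixedSubalgebra_iff {a : CoordinateRing k V} :
    SymmetricAlgebra.equivMvPolynomial b a ∈ fixedSubalgebra (polyAction G b) ↔
      a ∈ invariantRing G := by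
  constructor
  · intro h σ hσ
    have := h ⟨σ, hσ⟩
    rw [polyAction_equivMvPolynomial] at this
    exact (SymmetricAlgebra.equivMvPolynomial b).injective this
  · intro h g
    rw [polyAction_equivMvPolynomial, h g g.2]

theorem map_invariantRing :
    (invariantRing G).map
      (SymmetricAlgebra.equivMvPolynomial b : CoordinateRing k V →ₐ[k] MvPolynomial κ k) =
      fixedSubalgebra (polyAction G b) := by
  ext a
  constructor
  · rintro ⟨c, hc, rfl⟩
    exact (equivMvPolynomial_mem_fixedSubalgebra_iff G b).2 hc
  · intro ha
    refine ⟨(SymmetricAlgebra.equivMvPolynomial b).symm a,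
      (equivMvPolynomial_mem_fixedSubalgebra_iff G b).1 ?_, ?_⟩
    · simpa using ha
    · simp

theorem equivMvPolynomial_transfer [Fintype G] (a : CoordinateRing k V) :
    SymmetricAlgebra.equivMvPolynomial b (transfer G a : CoordinateRing k V) =
      ∑ g, polyAction G b g (SymmetricAlgebra.equivMvPolynomial b a) := by
  simp only [polyAction_equivMvPolynomial, ← map_sum]
  rfl

theorem isPrincipal_range_transfer_iff [Fintype G] :
    (LinearMap.range (transfer G)).IsPrincipal ↔
      ∃ J ∈ fixedSubalgebra (polyAction G b), (∃ a, ∑ g, polyAction G b g a = J) ∧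
        ∀ a, ∃ c ∈ fixedSubalgebra (polyAction G b), ∑ g, polyAction G b g a = J * c := by
  let Φ := SymmetricAlgebra.equivMvPolynomial b
  constructor
  · rintro ⟨d, hd⟩
    refine ⟨Φ d, (equivMvPolynomial_mem_fixedSubalgebra_iff G b).2 d.2, ?_, fun a => ?_⟩
    · have : d ∈ LinearMap.range (transfer G) := by
        rw [hd]
        exact Submodule.mem_span_singleton_self d
      obtain ⟨a, ha⟩ := this
      exact ⟨Φ a, by rw [← equivMvPolynomial_transfer, ha]⟩
    · have : transfer G (Φ.symm a) ∈ Submodule.span (invariantRing G) {d} := by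
        rw [← hd]
        exact ⟨_, rfl⟩
      obtain ⟨c, hc⟩ := Submodule.mem_span_singleton.1 this
      refine ⟨Φ c, (equivMvPolynomial_mem_fixedSubalgebra_iff G b).2 c.2, ?_⟩
      have h1 := equivMvPolynomial_transfer G b (Φ.symm a)
      rw [← hc] at h1
      simp only [Φ, AlgEquiv.apply_symm_apply] at h1
      rw [← h1, smul_eq_mul, mul_comm]
      simp [Φ]
  · rintro ⟨J, hJ, ⟨a₀, ha₀⟩, h⟩
    have hd : Φ.symm J ∈ invariantRing G :=
      (equivMvPolynomial_mem_fixedSubalgebra_iff G b).1 (by simpa [Φ] using hJ)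
    refine ⟨⟨Φ.symm J, hd⟩, le_antisymm ?_ ?_⟩
    · rintro _ ⟨a, rfl⟩
      obtain ⟨c, hc, hac⟩ := h (Φ a)
      refine Submodule.mem_span_singleton.2 ⟨⟨Φ.symm c,
        (equivMvPolynomial_mem_fixedSubalgebra_iff G b).1 (by simpa [Φ] using hc)⟩, ?_⟩
      refine Subtype.ext (Φ.injective ?_)
      rw [equivMvPolynomial_transfer, hac]
      simp [mul_comm]
    · rw [Submodule.span_singleton_le_iff_mem]
      refine ⟨Φ.symm a₀, Subtype.ext (Φ.injective ?_)⟩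
      rw [equivMvPolynomial_transfer]
      simpa [Φ] using ha₀

theorem equivMvPolynomial_isHomogeneous_iff [Fintype κ] {a : CoordinateRing k V} {d : ℕ} :
    (SymmetricAlgebra.equivMvPolynomial b a).IsHomogeneous d ↔ a ∈ homogeneousPart k V d := by
  let Φ := SymmetricAlgebra.equivMvPolynomial b
  have h1 : (LinearMap.range (SymmetricAlgebra.ι k (Module.Dual k V))).map
      (Φ : CoordinateRing k V →ₐ[k] MvPolynomial κ k).toLinearMap = homogeneousSubmodule κ k 1 := by
    rw [homogeneousSubmodule_one_eq_span_X]
    refine le_antisymm ?_ ?_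
    · rintro _ ⟨_, ⟨x, rfl⟩, rfl⟩
      change linearForm b x ∈ _
      rw [linearForm_eq_sum]
      exact sum_mem fun i _ => Submodule.smul_mem _ _ (Submodule.subset_span ⟨i, rfl⟩)
    · rw [Submodule.span_le]
      rintro _ ⟨i, rfl⟩
      exact ⟨_, ⟨b i, rfl⟩, linearForm_basis b i⟩
  have h2 : (homogeneousPart k V d).map
      (Φ : CoordinateRing k V →ₐ[k] MvPolynomial κ k).toLinearMap = homogeneousSubmodule κ k d := by
    rw [homogeneousPart, Submodule.map_pow, h1, homogeneousSubmodule_one_pow]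
  rw [← mem_homogeneousSubmodule, ← h2]
  constructor
  · rintro ⟨c, hc, hca⟩
    rwa [← Φ.injective hca]
  · intro h
    exact ⟨a, h, rfl⟩

theorem isCoregular_iff [Fintype κ] : IsCoregular G ↔
    IsPolynomialSubalgebra (fixedSubalgebra (polyAction G b)) (Module.finrank k V) := by
  let Φ := SymmetricAlgebra.equivMvPolynomial b
  constructor
  · rintro ⟨f, hf, hai, hadj⟩
    refine ⟨fun i => Φ (f i), fun i => ?_, ?_, ?_⟩
    · obtain ⟨d, hd⟩ := hf i
      exact ⟨d, (equivMvPolynomial_isHomogeneous_iff b).2 hd⟩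
    · exact hai.map' (f := (Φ : CoordinateRing k V →ₐ[k] MvPolynomial κ k)) Φ.injective
    · rw [← map_invariantRing, ← hadj, AlgHom.map_adjoin, ← Set.range_comp]
      rfl
  · rintro ⟨f, hf, hai, hadj⟩
    refine ⟨fun i => Φ.symm (f i), fun i => ?_, ?_, ?_⟩
    · obtain ⟨d, hd⟩ := hf i
      refine ⟨d, (equivMvPolynomial_isHomogeneous_iff b).1 ?_⟩
      simpa [Φ] using hd
    · exact hai.map' (f := (Φ.symm : MvPolynomial κ k →ₐ[k] CoordinateRing k V)) Φ.symm.injective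
    · refine Subalgebra.map_injective
        (f := (Φ : CoordinateRing k V →ₐ[k] MvPolynomial κ k)) Φ.injective ?_
      rw [map_invariantRing, ← hadj, AlgHom.map_adjoin, ← Set.range_comp]
      congr 2
      ext i
      simp

end Transport

/-! ### The two implications -/

section Main

open MvPolynomial

variable {k V : Type*} [Field k] [AddCommGroup V] [Module k V] [FiniteDimensional k V]
  (p : ℕ) [Fact p.Prime] [CharP k p] (G : Subgroup (LinearMap.GeneralLinearGroup k V)) [Fintype G]

theorem isPrincipal_of_isCoregular (hp : IsPGroup p G) (h : IsCoregular G) :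
    (LinearMap.range (transfer G)).IsPrincipal := by
  -- The variables are indexed like the generators in `IsCoregular`, which makes the Jacobian matrix
  -- square.
  let b := (Module.finBasis k (Module.Dual k V)).reindex
    (finCongr (Subspace.dual_finrank_eq (K := k) (V := V)))
  rw [isPrincipal_range_transfer_iff G b]
  obtain ⟨f, hf, hai, hadj⟩ := (isCoregular_iff G b).1 h
  exact exists_generator_of_algebraicIndependent p hp (isLinearAction_polyAction G b)
    (polyAction_injective G b) hf hai hadj

omit [FiniteDimensional k V] [Fintype G] in
-- In characteristic p, (g - 1)^(p^N) = g^(p^N) - 1.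
theorem exists_pow_dualRep_sub_one_eq_zero (hp : IsPGroup p G) (g : G) :
    ∃ n : ℕ, (dualRep G g - 1) ^ n = 0 := by
  obtain ⟨N, hN⟩ := hp g
  refine ⟨p ^ N, ?_⟩
  rcases subsingleton_or_nontrivial (Module.Dual k V) with h | h
  · exact LinearMap.ext fun x => Subsingleton.elim _ _
  · have : CharP (Module.End k (Module.Dual k V)) p :=
      charP_of_injective_algebraMap (algebraMap k (Module.End k (Module.Dual k V))).injective p
    have hsub := sub_pow_char_pow_of_commute (R := Module.End k (Module.Dual k V)) p N
      (Commute.one_right (dualRep G g))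
    rw [hsub, ← map_pow, hN, map_one, one_pow, sub_self]

theorem isCoregular_of_isPrincipal (hcomm : ∀ g h : G, g * h = h * g) (hp : IsPGroup p G)
    (h : (LinearMap.range (transfer G)).IsPrincipal) : IsCoregular G := by
  classical
  have hfix : ∀ (g h : G) (x : Module.Dual k V),
      dualRep G g (dualRep G h x - x) = dualRep G h x - x := by
    let b := Module.finBasis k (Module.Dual k V)
    obtain ⟨J, hJ, hJim, hJdvd⟩ := (isPrincipal_range_transfer_iff G b).1 h
    have htop := eq_top_of_isReflection_mem p hp hcomm (isLinearAction_polyAction G b)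
      (polyAction_injective G b) (Subgroup.closure {σ | IsReflection (polyAction G b) σ})
      (fun σ hσ => Subgroup.subset_closure hσ) hJ hJim fun a => by
        obtain ⟨c, -, hc⟩ := hJdvd a
        exact ⟨c, hc⟩
    refine map_sub_eq_self_of_closure_eq_top (dualRep G) hcomm
      (exists_pow_dualRep_sub_one_eq_zero p G hp) (fun σ hσ => ?_) htop
    obtain ⟨i₀, hi₀⟩ := hσ
    choose c hc using hi₀
    refine ⟨dualRep G σ (b i₀) - b i₀, fun x => ⟨∑ i, b.repr x i * c i, ?_⟩⟩
    have h1 : ∀ i, dualRep G σ (b i) - b i = c i • (dualRep G σ (b i₀) - b i₀) := by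
      intro i
      refine linearForm_injective b ?_
      have := hc i
      rwa [polyAction_X, polyAction_X, ← linearForm_basis b, ← linearForm_basis b i₀, ← map_sub,
        ← map_sub, ← map_smul] at this
    have h2 : dualRep G σ x - x = ∑ i, b.repr x i • (dualRep G σ (b i) - b i) := by
      conv_lhs => rw [← b.sum_repr x]
      simp only [map_sum, map_smul, smul_sub, Finset.sum_sub_distrib]
    rw [h2, Finset.sum_smul]
    exact Finset.sum_congr rfl fun i _ => by rw [h1 i, smul_smul]
  let F : Submodule k (Module.Dual k V) := ⨅ g : G, LinearMap.ker (dualRep G g - 1)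
  have hF : ∀ x, x ∈ F ↔ ∀ g : G, dualRep G g x = x := by
    intro x
    simp [F, sub_eq_zero]
  -- By `hfix` every difference gx - x lies in the fixed space F. A basis extending one of F is
  -- therefore of the form x, y treated above, and principality is read again in this new basis.
  obtain ⟨m, r, b, hbF, hF'⟩ := exists_basis_sum_of_submodule F
  have hcard : m + r = Module.finrank k V := by
    have := Module.finrank_eq_card_basis b
    rw [Subspace.dual_finrank_eq] at this
    simpa using this.symm
  obtain ⟨J, hJ, hJim, hJdvd⟩ := (isPrincipal_range_transfer_iff G b).1 h
  have hJ0 : J ≠ 0 := by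
    rintro rfl
    obtain ⟨a, ha⟩ := exists_sum_ne_zero _ (polyAction_injective G b)
    obtain ⟨c, -, hc⟩ := hJdvd a
    exact ha (by rw [hc, zero_mul])
  have hgen := isGeneratedByHomogeneous_fixedSubalgebra p hp (isLinearAction_polyAction G b)
    (fun g i => by rw [polyAction_X, (hF _).1 (hbF i) g, linearForm_basis])
    (fun g j => by
      obtain ⟨c, hc⟩ := hF' (dualRep G g (b (.inr j)) - b (.inr j))
        ((hF _).2 fun g' => hfix g' g _)
      refine ⟨∑ i, c i • X i, ?_, ?_⟩
      · refine IsHomogeneous.sum _ _ _ fun i _ => ?_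
        rw [smul_eq_C_mul]
        exact isHomogeneous_C_mul_X _ _
      · rw [polyAction_X, ← sub_add_cancel (dualRep G g (b (.inr j))) (b (.inr j)), hc, map_add,
          linearForm_basis, add_comm, map_sum, map_sum]
        simp [linearForm_basis])
    (hasRetraction_of_dvd_sum hJ0 hJim hJdvd)
  rw [isCoregular_iff G b, ← hcard]
  have hcard' : Fintype.card (Fin m ⊕ Fin r) = m + r := by simp
  rw [← hcard'] at hgen ⊢
  exact hgen.isPolynomialSubalgebra (isIntegral_fixedSubalgebra _)

end Main

end InvariantTheory

end

theorem mainTheorem2 {k V : Type*} [Field k] [AddCommGroup V] [Module k V]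
    [FiniteDimensional k V] (p : ℕ) [Fact p.Prime] [CharP k p]
    (G : Subgroup (LinearMap.GeneralLinearGroup k V)) [Fintype G]
    (hab : ∀ σ ∈ G, ∀ τ ∈ G, σ * τ = τ * σ) (hp : IsPGroup p G) :
    (LinearMap.range (InvariantTheory.transfer G)).IsPrincipal ↔
      InvariantTheory.IsCoregular G :=
  ⟨InvariantTheory.isCoregular_of_isPrincipal p G
    (fun g h => Subtype.ext (hab g g.2 h h.2)) hp,
    InvariantTheory.isPrincipal_of_isCoregular p G hp⟩
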